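/- Let $N\ge 1$. For an integrable potential $V=V^*\in L^1(0,1)$ with values in the $N\times N$ complex matrices, let $H$ be the self-adjoint operator $H\psi=-\psi''+V\psi$ in $L^2(0,1)^N$ with boundary conditions $\psi(0)=\psi(1)=0$, let $\lambda_1<\lambda_2<\dots$ be its distinct eigenvalues, and let $k_\alpha$ be the multiplicity of $\lambda_\alpha$. Let $\varphi(x,\lambda)$ be the $N\times N$ matrix-valued solution of $-\varphi''+V\varphi=\lambda\varphi$ with $\varphi(0,\lambda)=0$, $\varphi'(0,\lambda)=I$. For $\alpha\ge 1$ put $$S_\alpha=\int_0^1\varphi(t,\lambda_\alpha)^*\varphi(t,\lambda_\alpha)\,dt,\qquad \mathcal E_\alpha=\operatorname{Ker}\varphi(1,\lambda_\alpha)\subset\mathbb C^N,$$ and let the forbidden subspace $\mathcal F_\alpha=\mathbb C^N\ominus S_\alpha(\mathcal E_\alpha)$ be the orthogonal complement of $S_\alpha(\mathcal E_\alpha)$ in $\mathbb C^N$. Quantities that belong to another potential $\widetilde V$ carry a tilde. Let $V=V^*\in L^1(0,1)$, and let $\widetilde V=\widetilde V^*\in L^1(0,1)$ be isospectral to $V$,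 i.e. $\widetilde\lambda_\beta=\lambda_\beta$ and $\widetilde k_\beta=k_\beta$ for all $\beta\ge 1$. Fix $\alpha\ge 1$ and suppose that $\widetilde{\mathcal E}_\beta=\mathcal E_\beta$ for all $\beta\ne\alpha$. Then $$\widetilde{\mathcal F}_\alpha=\mathcal F_\alpha\qquad\text{and}\qquad \widetilde{\mathcal E}_\alpha\cap\mathcal F_\alpha=\{0\}.$$ In particular, $\mathcal F_\alpha$ is determined by the spectrum (with multiplicities) together with the subspaces $\mathcal E_\beta$, $\beta\ne\alpha$. -/

import Mathlib

open MeasureTheory Set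
open scoped Matrix

noncomputable section

namespace MatrixSchrodinger

variable {N : ℕ}

/-- `V = V* ∈ L¹(0,1)`: the function `V` (its values off `(0,1)` are irrelevant) represents an
integrable Hermitian `N × N` matrix potential on `(0,1)`. -/
def IsPotential (V : ℝ → Matrix (Fin N) (Fin N) ℂ) : Prop :=
  (∀ i j, IntegrableOn (fun x => V x i j) (Ioo 0 1)) ∧
    ∀ᵐ x ∂(volume.restrict (Ioo (0 : ℝ) 1)), (V x).IsHermitian

/-- The right-hand side of `ψ'' = V ψ - lam ψ`. -/
def rhs (V : ℝ → Matrix (Fin N) (Fin N) ℂ) (lam : ℂ)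
    (ψ : ℝ → EuclideanSpace ℂ (Fin N)) (t : ℝ) : EuclideanSpace ℂ (Fin N) :=
  Matrix.toEuclideanLin (V t) (ψ t) - lam • ψ t

/-- `ψ` solves `-ψ'' + V ψ = lam ψ` on `[0,1]` and `p` is its derivative. As usual for an
integrable coefficient this means: `ψ` is continuously differentiable with `ψ' = p`, `p` is
absolutely continuous, and `p' = V ψ - lam ψ` almost everywhere; both relations are written in
integrated form. -/
structure IsSolution (V : ℝ → Matrix (Fin N) (Fin N) ℂ) (lam : ℂ)
    (ψ p : ℝ → EuclideanSpace ℂ (Fin N)) : Prop where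
  continuousOn_deriv : ContinuousOn p (Icc 0 1)
  integrable_rhs : IntervalIntegrable (rhs V lam ψ) volume 0 1
  eq_integral : ∀ x ∈ Icc (0 : ℝ) 1, ψ x = ψ 0 + ∫ t in (0 : ℝ)..x, p t
  deriv_eq_integral : ∀ x ∈ Icc (0 : ℝ) 1, p x = p 0 + ∫ t in (0 : ℝ)..x, rhs V lam ψ t

/-- `Φ` is the `N × N` matrix solution of `-Φ'' + V Φ = lam Φ` on `[0,1]` with
`Φ(0) = 0` and `Φ'(0) = I`. The matrix equation is expressed by applying it to all vectors. -/
def IsDirichletSolution (V : ℝ → Matrix (Fin N) (Fin N) ℂ) (lam : ℂ)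
    (Φ : ℝ → Matrix (Fin N) (Fin N) ℂ) : Prop :=
  ∃ P : ℝ → Matrix (Fin N) (Fin N) ℂ,
    (∀ h : EuclideanSpace ℂ (Fin N),
      IsSolution V lam (fun x => Matrix.toEuclideanLin (Φ x) h)
        (fun x => Matrix.toEuclideanLin (P x) h)) ∧
    Φ 0 = 0 ∧ P 0 = 1

/-- The matrix solution `φ(x, lam, V)`. For a potential `V` it exists and is unique on `[0,1]`;
only its values on `[0,1]` are used. -/
def phi (V : ℝ → Matrix (Fin N) (Fin N) ℂ) (lam : ℂ) : ℝ → Matrix (Fin N) (Fin N) ℂ :=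
  Classical.epsilon (IsDirichletSolution V lam)

theorem IsSolution.zero (V : ℝ → Matrix (Fin N) (Fin N) ℂ) (lam : ℂ) :
    IsSolution V lam (0 : ℝ → EuclideanSpace ℂ (Fin N)) 0 := by
  have h : rhs V lam (0 : ℝ → EuclideanSpace ℂ (Fin N)) = 0 := by
    funext t; simp [rhs]
  refine ⟨continuousOn_const, ?_, ?_, ?_⟩
  · rw [h]; exact intervalIntegrable_const
  · intro x _; simp
  · intro x _; rw [h]; simp

theorem IsSolution.add {V : ℝ → Matrix (Fin N) (Fin N) ℂ} {lam : ℂ}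
    {ψ p χ q : ℝ → EuclideanSpace ℂ (Fin N)}
    (h₁ : IsSolution V lam ψ p) (h₂ : IsSolution V lam χ q) :
    IsSolution V lam (ψ + χ) (p + q) := by
  have h : rhs V lam (ψ + χ) = rhs V lam ψ + rhs V lam χ := by
    funext t; simp only [rhs, Pi.add_apply, map_add, smul_add]; abel
  have sub : ∀ x ∈ Icc (0 : ℝ) 1, uIcc 0 x ⊆ uIcc (0 : ℝ) 1 := fun x hx => by
    rw [uIcc_of_le hx.1, uIcc_of_le zero_le_one]; exact Icc_subset_Icc_right hx.2
  have hp : IntervalIntegrable p volume 0 1 :=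
    ContinuousOn.intervalIntegrable (by rw [uIcc_of_le zero_le_one]; exact h₁.1)
  have hq : IntervalIntegrable q volume 0 1 :=
    ContinuousOn.intervalIntegrable (by rw [uIcc_of_le zero_le_one]; exact h₂.1)
  refine ⟨h₁.1.add h₂.1, ?_, ?_, ?_⟩
  · rw [h]; exact h₁.2.add h₂.2
  · intro x hx
    have := intervalIntegral.integral_add (hp.mono_set (sub x hx)) (hq.mono_set (sub x hx))
    simp only [Pi.add_apply]
    rw [this, h₁.3 x hx, h₂.3 x hx]; abel
  · intro x hx
    have := intervalIntegral.integral_add (h₁.2.mono_set (sub x hx)) (h₂.2.mono_set (sub x hx))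
    rw [h]
    simp only [Pi.add_apply]
    rw [this, h₁.4 x hx, h₂.4 x hx]; abel

theorem IsSolution.smul {V : ℝ → Matrix (Fin N) (Fin N) ℂ} {lam : ℂ}
    {ψ p : ℝ → EuclideanSpace ℂ (Fin N)} (c : ℂ) (h₁ : IsSolution V lam ψ p) :
    IsSolution V lam (c • ψ) (c • p) := by
  have h : rhs V lam (c • ψ) = c • rhs V lam ψ := by
    funext t
    simp only [rhs, Pi.smul_apply, map_smul, smul_sub]
    rw [smul_comm]
  refine ⟨h₁.1.const_smul c, ?_, ?_, ?_⟩
  · rw [h]; exact h₁.2.smul c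
  · intro x hx
    simp only [Pi.smul_apply]
    rw [intervalIntegral.integral_smul, h₁.3 x hx, smul_add]
  · intro x hx
    rw [h]
    simp only [Pi.smul_apply]
    rw [intervalIntegral.integral_smul, h₁.4 x hx, smul_add]

/-- The space of solutions of `-ψ'' + V ψ = lam ψ`, `ψ(0) = ψ(1) = 0`, that is, the
eigenfunctions (and `0`) of the Dirichlet operator `H` for the number `lam`. A function on `[0,1]`
is represented by its extension by zero to the line. -/
def eigenspace (V : ℝ → Matrix (Fin N) (Fin N) ℂ) (lam : ℂ) :
    Submodule ℂ (ℝ → EuclideanSpace ℂ (Fin N)) where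
  carrier := {ψ | (∀ x, x ∉ Icc (0 : ℝ) 1 → ψ x = 0) ∧ ψ 0 = 0 ∧ ψ 1 = 0 ∧
    ∃ p, IsSolution V lam ψ p}
  zero_mem' := ⟨fun _ _ => rfl, rfl, rfl, 0, IsSolution.zero V lam⟩
  add_mem' := by
    rintro ψ χ ⟨h₁, h₂, h₃, p, hp⟩ ⟨k₁, k₂, k₃, q, hq⟩
    exact ⟨fun x hx => by simp [h₁ x hx, k₁ x hx], by simp [h₂, k₂], by simp [h₃, k₃],
      p + q, hp.add hq⟩
  smul_mem' := by
    rintro c ψ ⟨h₁, h₂, h₃, p, hp⟩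
    exact ⟨fun x hx => by simp [h₁ x hx], by simp [h₂], by simp [h₃], c • p, hp.smul c⟩

/-- The set of eigenvalues of the self-adjoint operator `H`. -/
def eigenvalues (V : ℝ → Matrix (Fin N) (Fin N) ℂ) : Set ℝ :=
  {μ | eigenspace V (μ : ℂ) ≠ ⊥}

/-- The distinct eigenvalues in increasing order, indexed from `0`: the smallest eigenvalue, and
then repeatedly the next one. -/
def eigenvalue (V : ℝ → Matrix (Fin N) (Fin N) ℂ) : ℕ → ℝ
  | 0 => sInf (eigenvalues V)
  | n + 1 => sInf {μ | μ ∈ eigenvalues V ∧ eigenvalue V n < μ}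

/-- The multiplicity `k_α` of the eigenvalue with index `α`. -/
def eigenvalueMultiplicity (V : ℝ → Matrix (Fin N) (Fin N) ℂ) (α : ℕ) : ℕ :=
  Module.finrank ℂ (eigenspace V (eigenvalue V α : ℂ))

/-- The isospectral set `Iso(V)`. -/
def Iso (V : ℝ → Matrix (Fin N) (Fin N) ℂ) : Set (ℝ → Matrix (Fin N) (Fin N) ℂ) :=
  {W | IsPotential W ∧ ∀ α, eigenvalue W α = eigenvalue V α ∧
    eigenvalueMultiplicity W α = eigenvalueMultiplicity V α}

/-- `S_α = ∫₀¹ φ(t, λ_α)* φ(t, λ_α) dt`, entry by entry. -/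
def S (V : ℝ → Matrix (Fin N) (Fin N) ℂ) (α : ℕ) : Matrix (Fin N) (Fin N) ℂ :=
  Matrix.of fun i j => ∫ t in (0 : ℝ)..1,
    ((phi V (eigenvalue V α : ℂ) t)ᴴ * phi V (eigenvalue V α : ℂ) t) i j

/-- `E_α = Ker φ(1, λ_α)`. -/
def E (V : ℝ → Matrix (Fin N) (Fin N) ℂ) (α : ℕ) : Submodule ℂ (EuclideanSpace ℂ (Fin N)) :=
  LinearMap.ker (Matrix.toEuclideanLin (phi V (eigenvalue V α : ℂ) 1))

/-- The forbidden subspace `F_α = ℂ^N ⊖ S_α(E_α)`. -/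
def F (V : ℝ → Matrix (Fin N) (Fin N) ℂ) (α : ℕ) : Submodule ℂ (EuclideanSpace ℂ (Fin N)) :=
  ((E V α).map (Matrix.toEuclideanLin (S V α)))ᗮ

end MatrixSchrodinger

end

/-!
Put `M_V(lam) = φ(1, lam)`, `D_V(lam) = φ'(1, lam)` for the potential `V`, and let `mu = λ_α`,
`a ∈ E_α(V)`. The Lagrange identity gives
`⟪D_V(mu) a, M_V(lam) b⟫ = (lam - mu) ⟪φ_V(mu) a, φ_V(lam) b⟫`,
so the row `⟪D_V(mu) a, M_V(lam) ·⟫` vanishes at `lam = mu`; at every other eigenvalue `nu` it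
vanishes on `Ker M_V(nu) = Ker M_W(nu)`. Since the inverse of `M_W` has only simple poles, its
product with this row is an entire function of `lam`. It is bounded because `M_V(z²)` and `M_W(z²)`
are both `sin z / z` to leading order, hence constant by Liouville:
`⟪D_V(mu) a, M_V(lam) b⟫ = ⟪c, M_W(lam) b⟫` for all `lam` and `b`.
The vector `c` is orthogonal to the range of `M_W(mu)`, hence `c = D_W(mu) a'` with `a' ∈ E_α(W)`.
Applying the Lagrange identity on both sides, dividing by `lam - mu` and letting `lam → mu` yields
`S_α(V) a = S_α(W) a'`. Thus `S_α(V)` maps `E_α(V)` into the image of `E_α(W)` under `S_α(W)`, and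
equality holds by symmetry. The second claim follows from `⟪S_α(W) a, a⟫ = ‖φ_W(mu) a‖²`.
-/

noncomputable section

namespace MatrixSchrodinger

open Filter Topology

section Primitives

variable {X Y Z : Type*} [NormedAddCommGroup X] [NormedSpace ℝ X]
  [NormedAddCommGroup Y] [NormedSpace ℝ Y] [NormedAddCommGroup Z] [NormedSpace ℝ Z]
  {u u' : ℝ → X} {v v' : ℝ → Y} {a b x : ℝ}

/-- `u` is, on the interval with endpoints `a` and `b`, a primitive of the integrable function
`u'`: the functions with this property are the absolutely continuous ones that are differentiable
almost everywhere. -/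
structure IsPrimitiveOn (u u' : ℝ → X) (a b : ℝ) : Prop where
  intervalIntegrable : IntervalIntegrable u' volume a b
  eq_add_integral : ∀ x ∈ uIcc a b, u x = u a + ∫ t in a..x, u' t

theorem isPrimitiveOn_of_hasDerivAt [CompleteSpace X] (h : ∀ x, HasDerivAt u (u' x) x)
    (hu' : Continuous u') : IsPrimitiveOn u u' a b where
  intervalIntegrable := hu'.intervalIntegrable a b
  eq_add_integral x _ := by
    rw [intervalIntegral.integral_eq_sub_of_hasDerivAt (fun t _ => h t)
      (hu'.intervalIntegrable a x), add_sub_cancel]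

theorem absolutelyContinuousOnInterval_of_dist_le {X Y : Type*} [PseudoMetricSpace X]
    [PseudoMetricSpace Y] {f : ℝ → X} {g : ℝ → Y} {a b : ℝ}
    (hf : AbsolutelyContinuousOnInterval f a b)
    (h : ∀ x ∈ uIcc a b, ∀ y ∈ uIcc a b, dist (g x) (g y) ≤ dist (f x) (f y)) :
    AbsolutelyContinuousOnInterval g a b := by
  rw [absolutelyContinuousOnInterval_iff] at hf ⊢
  intro ε hε
  obtain ⟨δ, hδ, H⟩ := hf ε hε
  exact ⟨δ, hδ, fun I hI hI' => (Finset.sum_le_sum fun i hi =>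
    h _ (hI.1 i hi).1 _ (hI.1 i hi).2).trans_lt (H I hI hI')⟩

theorem IsPrimitiveOn.intervalIntegrable_left (h : IsPrimitiveOn u u' a b) (hx : x ∈ uIcc a b) :
    IntervalIntegrable u' volume a x :=
  h.intervalIntegrable.mono_set (uIcc_subset_uIcc_left hx)

theorem IsPrimitiveOn.mono_right (h : IsPrimitiveOn u u' a b) (hx : x ∈ uIcc a b) :
    IsPrimitiveOn u u' a x where
  intervalIntegrable := h.intervalIntegrable_left hx
  eq_add_integral y hy := h.eq_add_integral y (uIcc_subset_uIcc_left hx hy)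

theorem IsPrimitiveOn.sub_eq_integral (h : IsPrimitiveOn u u' a b) {y : ℝ} (hx : x ∈ uIcc a b)
    (hy : y ∈ uIcc a b) : u x - u y = ∫ t in y..x, u' t := by
  rw [h.eq_add_integral x hx, h.eq_add_integral y hy, add_sub_add_left_eq_sub,
    intervalIntegral.integral_interval_sub_left (h.intervalIntegrable_left hx)
      (h.intervalIntegrable_left hy)]

theorem IsPrimitiveOn.absolutelyContinuousOnInterval (h : IsPrimitiveOn u u' a b) :
    AbsolutelyContinuousOnInterval u a b := by
  have hnorm : IsPrimitiveOn (fun x => ∫ t in a..x, ‖u' t‖) (fun t => ‖u' t‖) a b :=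
    ⟨h.intervalIntegrable.norm, fun x _ => by simp⟩
  refine absolutelyContinuousOnInterval_of_dist_le
    (h.intervalIntegrable.norm.absolutelyContinuousOnInterval_intervalIntegral left_mem_uIcc)
    fun x hx y hy => ?_
  rw [dist_eq_norm, Real.dist_eq, h.sub_eq_integral hx hy, hnorm.sub_eq_integral hx hy]
  exact intervalIntegral.norm_integral_le_abs_integral_norm

theorem IsPrimitiveOn.continuousOn (h : IsPrimitiveOn u u' a b) : ContinuousOn u (uIcc a b) :=
  h.absolutelyContinuousOnInterval.continuousOn

theorem IsPrimitiveOn.ae_hasDerivAt [CompleteSpace X] (h : IsPrimitiveOn u u' a b) :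
    ∀ᵐ x, x ∈ uIcc a b → HasDerivAt u (u' x) x := by
  filter_upwards [h.intervalIntegrable.ae_hasDerivAt_integral,
    Measure.ae_ne volume a, Measure.ae_ne volume b] with x hderiv hxa hxb hx
  have hnhds : uIcc a b ∈ 𝓝 x := by
    refine Icc_mem_nhds (lt_of_le_of_ne hx.1 ?_) (lt_of_le_of_ne hx.2 ?_)
    · rcases min_choice a b with h | h <;> rw [h] <;> exact Ne.symm ‹_›
    · rcases max_choice a b with h | h <;> rw [h] <;> assumption
  exact ((hderiv hx a left_mem_uIcc).const_add (u a)).congr_of_eventuallyEq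
    (eventually_of_mem hnhds h.eq_add_integral)

theorem isPrimitiveOn_of_ae_hasDerivAt [CompleteSpace X] (hu : AbsolutelyContinuousOnInterval u a b)
    (hu' : IntervalIntegrable u' volume a b)
    (h : ∀ᵐ x, x ∈ uIcc a b → HasDerivAt u (u' x) x) : IsPrimitiveOn u u' a b := by
  have hprim : IsPrimitiveOn (fun x => ∫ t in a..x, u' t) u' a b := ⟨hu', fun x _ => by simp⟩
  have hzero : ∀ᵐ x, x ∈ uIcc a b → HasDerivAt (u - fun x => ∫ t in a..x, u' t) 0 x := by
    filter_upwards [h, hprim.ae_hasDerivAt] with x h₁ h₂ hx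
    simpa only [sub_self] using (h₁ hx).sub (h₂ hx)
  obtain ⟨C, hC⟩ := AbsolutelyContinuousOnInterval.const_of_ae_hasDerivAt_zero
    (hu.sub hprim.absolutelyContinuousOnInterval) hzero
  simp only [Pi.sub_apply] at hC
  refine ⟨hu', fun x hx => ?_⟩
  have hCa := hC a left_mem_uIcc
  rw [intervalIntegral.integral_same, sub_zero] at hCa
  rw [hCa, ← hC x hx, sub_add_cancel]

theorem absolutelyContinuousOnInterval_bilinear {β : X × Y → Z} (hβ : IsBoundedBilinearMap ℝ β)
    (hu : AbsolutelyContinuousOnInterval u a b) (hv : AbsolutelyContinuousOnInterval v a b) :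
    AbsolutelyContinuousOnInterval (fun x => β (u x, v x)) a b := by
  obtain ⟨C, hC⟩ := hu.exists_bound
  obtain ⟨D, hD⟩ := hv.exists_bound
  obtain ⟨M, hM, hβM⟩ := hβ.bound
  have hlim := (Tendsto.const_mul (M * D) hu).add (Tendsto.const_mul (M * C) hv)
  rw [mul_zero, mul_zero, add_zero] at hlim
  refine squeeze_zero' (Eventually.of_forall fun I => by positivity) ?_ hlim
  filter_upwards [mem_inf_of_right (mem_principal_self _)] with I hI
  rw [Finset.mul_sum, Finset.mul_sum, ← Finset.sum_add_distrib]
  refine Finset.sum_le_sum fun i hi => ?_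
  obtain ⟨hx, hy⟩ := hI.1 i hi
  set x := (I.2 i).1
  set y := (I.2 i).2
  have hsplit : β (u x, v x) - β (u y, v y) = β (u x - u y, v x) + β (u y, v x - v y) := by
    rw [hβ.map_sub_left, hβ.map_sub_right, sub_add_sub_cancel]
  calc dist (β (u x, v x)) (β (u y, v y))
      ≤ M * ‖u x - u y‖ * ‖v x‖ + M * ‖u y‖ * ‖v x - v y‖ := by
        rw [dist_eq_norm, hsplit]
        exact (norm_add_le _ _).trans (add_le_add (hβM _ _) (hβM _ _))
    _ ≤ M * ‖u x - u y‖ * D + M * C * ‖v x - v y‖ := by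
        gcongr
        exacts [hD x hx, hC y hy]
    _ = M * D * dist (u x) (u y) + M * C * dist (v x) (v y) := by
        rw [dist_eq_norm, dist_eq_norm, mul_right_comm]

theorem intervalIntegrable_bilinear_left {β : X × Y → Z} (hβ : IsBoundedBilinearMap ℝ β)
    (hu : IntervalIntegrable u volume a b) (hv : ContinuousOn v (uIcc a b)) :
    IntervalIntegrable (fun t => β (u t, v t)) volume a b := by
  obtain ⟨M, hM, hβM⟩ := hβ.bound
  obtain ⟨C, hC⟩ := isCompact_uIcc.exists_bound_of_continuousOn hv
  have hv' := (hv.mono uIoc_subset_uIcc).aestronglyMeasurable (μ := volume) measurableSet_uIoc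
  refine (hu.norm.const_mul (M * C)).mono_fun' (hβ.continuous.comp_aestronglyMeasurable
    (hu.aestronglyMeasurable_restrict_uIoc.prodMk hv')) ?_
  filter_upwards [ae_restrict_mem measurableSet_uIoc] with t ht
  calc ‖β (u t, v t)‖ ≤ M * ‖u t‖ * ‖v t‖ := hβM _ _
    _ ≤ M * ‖u t‖ * C := by gcongr; exact hC t (uIoc_subset_uIcc ht)
    _ = M * C * ‖u t‖ := mul_right_comm _ _ _

theorem IsPrimitiveOn.bilinear [CompleteSpace X] [CompleteSpace Y] [CompleteSpace Z]
    {β : X × Y → Z} (hβ : IsBoundedBilinearMap ℝ β) (hu : IsPrimitiveOn u u' a b)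
    (hv : IsPrimitiveOn v v' a b) :
    IsPrimitiveOn (fun x => β (u x, v x)) (fun x => β (u' x, v x) + β (u x, v' x)) a b := by
  refine isPrimitiveOn_of_ae_hasDerivAt (absolutelyContinuousOnInterval_bilinear hβ
    hu.absolutelyContinuousOnInterval hv.absolutelyContinuousOnInterval)
    ((intervalIntegrable_bilinear_left hβ hu.intervalIntegrable hv.continuousOn).add
      (intervalIntegrable_bilinear_left (β := fun q => β (q.2, q.1)) hβ.symm
        hv.intervalIntegrable hu.continuousOn)) ?_
  filter_upwards [hu.ae_hasDerivAt, hv.ae_hasDerivAt] with x hux hvx hx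
  have := (hβ.hasFDerivAt (u x, v x)).comp_hasDerivAt x ((hux hx).prodMk (hvx hx))
  rw [add_comm]
  exact this

theorem IsPrimitiveOn.add (hu : IsPrimitiveOn u u' a b) {w w' : ℝ → X}
    (hw : IsPrimitiveOn w w' a b) :
    IsPrimitiveOn (fun x => u x + w x) (fun x => u' x + w' x) a b where
  intervalIntegrable := hu.intervalIntegrable.add hw.intervalIntegrable
  eq_add_integral x hx := by
    rw [intervalIntegral.integral_add (hu.intervalIntegrable_left hx)
      (hw.intervalIntegrable_left hx), hu.eq_add_integral x hx, hw.eq_add_integral x hx,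
      add_add_add_comm]

end Primitives

section FundamentalPair

variable {κ : ℂ} {s c : ℝ → ℂ}

/-- The scalar solutions `s` and `c` of `y'' = -κ y` with `s(0) = 0`, `s'(0) = 1` and `c(0) = 1`,
`c'(0) = 0`, together with the relation `s' = c`. -/
structure IsFundamentalPair (κ : ℂ) (s c : ℝ → ℂ) : Prop where
  hasDerivAt_left : ∀ x, HasDerivAt s (c x) x
  hasDerivAt_right : ∀ x, HasDerivAt c (-κ * s x) x
  left_zero : s 0 = 0
  right_zero : c 0 = 1

theorem IsFundamentalPair.continuous_left (h : IsFundamentalPair κ s c) : Continuous s :=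
  continuous_iff_continuousAt.2 fun x => (h.hasDerivAt_left x).continuousAt

theorem IsFundamentalPair.continuous_right (h : IsFundamentalPair κ s c) : Continuous c :=
  continuous_iff_continuousAt.2 fun x => (h.hasDerivAt_right x).continuousAt

theorem isFundamentalPair_zero : IsFundamentalPair 0 (fun x => (x : ℂ)) (fun _ => 1) where
  hasDerivAt_left _ := Complex.ofRealCLM.hasDerivAt
  hasDerivAt_right x := by simpa only [neg_zero, zero_mul] using hasDerivAt_const x (1 : ℂ)
  left_zero := Complex.ofReal_zero
  right_zero := rfl

theorem isFundamentalPair_sq {z : ℂ} (hz : z ≠ 0) :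
    IsFundamentalPair (z ^ 2) (fun x => Complex.sin (z * x) / z)
      (fun x => Complex.cos (z * x)) := by
  refine ⟨fun x => ?_, fun x => ?_, by simp, by simp⟩
  · have := ((hasDerivAt_const_mul z (x := (x : ℂ))).csin.div_const z).comp_ofReal
    rwa [mul_div_cancel_right₀ _ hz] at this
  · convert! (hasDerivAt_const_mul z (x := (x : ℂ))).ccos.comp_ofReal using 1
    field_simp

variable {H : Type*} [NormedAddCommGroup H] [NormedSpace ℂ H] [CompleteSpace H]
  {ψ p q : ℝ → H} {b x : ℝ}

theorem IsFundamentalPair.variation_of_parameters (h : IsFundamentalPair κ s c)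
    (hψ : IsPrimitiveOn ψ p 0 x) (hp : IsPrimitiveOn p q 0 x) :
    ψ x = c x • ψ 0 + s x • p 0 + ∫ t in (0 : ℝ)..x, s (x - t) • (q t + κ • ψ t) := by
  have hs := h.continuous_left
  have hc := h.continuous_right
  have hcx : IsPrimitiveOn (fun t => c (x - t)) (fun t => κ * s (x - t)) 0 x := by
    refine isPrimitiveOn_of_hasDerivAt (fun t => ?_) (by fun_prop)
    simpa only [neg_mul, neg_neg] using (h.hasDerivAt_right (x - t)).comp_const_sub x t
  have hsx : IsPrimitiveOn (fun t => s (x - t)) (fun t => -c (x - t)) 0 x :=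
    isPrimitiveOn_of_hasDerivAt (fun t => (h.hasDerivAt_left (x - t)).comp_const_sub x t)
      (by fun_prop)
  have hβ : IsBoundedBilinearMap ℝ fun q : ℂ × H => q.1 • q.2 := isBoundedBilinearMap_smul
  have hsum := ((hcx.bilinear hβ hψ).add (hsx.bilinear hβ hp)).eq_add_integral x right_mem_uIcc
  simp only [sub_self, sub_zero, h.left_zero, h.right_zero, one_smul, zero_smul, add_zero] at hsum
  rw [hsum]
  congr 1
  refine intervalIntegral.integral_congr fun t _ => ?_
  simp only [smul_add, neg_smul, smul_smul, mul_comm κ]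
  abel

end FundamentalPair

section IntegralOperator

variable {X : Type*} [TopologicalSpace X] [CompactSpace X]
  {H : Type*} [NormedAddCommGroup H] [NormedSpace ℂ H] {w : X → H →L[ℂ] H}

theorem norm_kernel_smul_le (K : C(X × X, ℂ)) (f : C(X, H)) (x t : X) :
    ‖K (x, t) • w t (f t)‖ ≤ ‖K‖ * ‖w t‖ * ‖f‖ := by
  rw [norm_smul, mul_assoc]
  gcongr
  · exact K.norm_coe_le_norm _
  · exact (w t).le_opNorm_of_le (f.norm_coe_le_norm t)

variable [SecondCountableTopology X] [MeasurableSpace X] [OpensMeasurableSpace X] {μ : Measure X}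

theorem integrable_clm_apply (hw : Integrable w μ) (f : C(X, H)) :
    Integrable (fun t => w t (f t)) μ := by
  refine (hw.norm.mul_const ‖f‖).mono' ?_ (Eventually.of_forall fun t => ?_)
  · exact isBoundedBilinearMap_apply.continuous.comp_aestronglyMeasurable
      (hw.1.prodMk f.continuous.aestronglyMeasurable)
  · exact (w t).le_opNorm_of_le (f.norm_coe_le_norm t)

theorem integrable_kernel_smul (K : C(X × X, ℂ)) (hw : Integrable w μ) (f : C(X, H)) (x : X) :
    Integrable (fun t => K (x, t) • w t (f t)) μ := by
  have hK : Continuous fun t => K (x, t) := by fun_prop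
  exact ((hw.norm.const_mul ‖K‖).mul_const ‖f‖).mono'
    (hK.aestronglyMeasurable.smul (integrable_clm_apply hw f).1)
    (Eventually.of_forall (norm_kernel_smul_le K f x))

/-- The integral operator `f ↦ ∫ K(·, t) w(t) f(t) dμ(t)` with continuous scalar kernel `K` and
integrable operator weight `w`, acting on continuous functions. -/
def integralOperator (K : C(X × X, ℂ)) (hw : Integrable w μ) : C(X, H) →L[ℂ] C(X, H) :=
  LinearMap.mkContinuous
    { toFun := fun f => ⟨fun x => ∫ t, K (x, t) • w t (f t) ∂μ,
        continuous_of_dominated (fun x => (integrable_kernel_smul K hw f x).1)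
          (fun x => Eventually.of_forall (norm_kernel_smul_le K f x))
          ((hw.norm.const_mul ‖K‖).mul_const ‖f‖)
          (Eventually.of_forall fun t => by fun_prop)⟩
      map_add' := fun f g => by
        ext x
        simp only [ContinuousMap.add_apply, ContinuousMap.coe_mk, map_add, smul_add]
        exact integral_add (integrable_kernel_smul K hw f x) (integrable_kernel_smul K hw g x)
      map_smul' := fun a f => by
        ext x
        simp only [ContinuousMap.smul_apply, ContinuousMap.coe_mk, map_smul, RingHom.id_apply,
          smul_comm _ a, integral_smul] }
    (‖K‖ * ∫ t, ‖w t‖ ∂μ) fun f => by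
      refine (ContinuousMap.norm_le _ (by positivity)).2 fun x => ?_
      rw [← integral_const_mul, ← integral_mul_const]
      exact norm_integral_le_of_norm_le ((hw.norm.const_mul ‖K‖).mul_const ‖f‖)
        (Eventually.of_forall (norm_kernel_smul_le K f x))

theorem integralOperator_apply (K : C(X × X, ℂ)) (hw : Integrable w μ) (f : C(X, H)) (x : X) :
    integralOperator K hw f x = ∫ t, K (x, t) • w t (f t) ∂μ := rfl

theorem norm_integralOperator_le (K : C(X × X, ℂ)) (hw : Integrable w μ) :
    ‖integralOperator K hw‖ ≤ ‖K‖ * ∫ t, ‖w t‖ ∂μ :=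
  LinearMap.mkContinuous_norm_le _ (by positivity) _

theorem integralOperator_add_smul (K : C(X × X, ℂ)) {w' : X → H →L[ℂ] H} (hw : Integrable w μ)
    (hw' : Integrable w' μ) (a : ℂ) :
    integralOperator K (hw.add (hw'.smul a)) =
      integralOperator K hw + a • integralOperator K hw' := by
  ext f x
  have hsum : ∀ t, K (x, t) • (w + a • w') t (f t) =
      K (x, t) • w t (f t) + a • K (x, t) • w' t (f t) := fun t => by
    rw [smul_comm a, ← smul_add]
    rfl
  calc integralOperator K (hw.add (hw'.smul a)) f x
      = ∫ t, K (x, t) • w t (f t) + a • K (x, t) • w' t (f t) ∂μ :=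
        integral_congr_ae (Eventually.of_forall hsum)
    _ = integralOperator K hw f x + a • integralOperator K hw' f x := by
        rw [integral_add (integrable_kernel_smul K hw f x)
          (by exact (integrable_kernel_smul K hw' f x).smul a), integral_smul]
        rfl

end IntegralOperator

section Multiplication

variable {X : Type*} [TopologicalSpace X] [CompactSpace X]
  {H : Type*} [NormedAddCommGroup H] [NormedSpace ℂ H]

/-- Multiplication by a continuous scalar function, acting on continuous functions. -/
def mulOperator (g : C(X, ℂ)) : C(X, H) →L[ℂ] C(X, H) :=
  LinearMap.mkContinuous
    { toFun := fun f => g • f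
      map_add' := smul_add g
      map_smul' := fun a f => by ext x; exact smul_comm _ _ _ } ‖g‖ fun f => by
    refine (ContinuousMap.norm_le _ (by positivity)).2 fun x => (norm_smul_le _ _).trans ?_
    exact mul_le_mul (g.norm_coe_le_norm x) (f.norm_coe_le_norm x) (norm_nonneg _) (norm_nonneg _)

/-- The operator that sends a vector `h` to the function `g(·) h`. -/
def smulConstOperator (g : C(X, ℂ)) : H →L[ℂ] C(X, H) :=
  LinearMap.mkContinuous
    { toFun := fun h => g • ContinuousMap.const X h
      map_add' := fun h h' => by ext x; exact smul_add _ _ _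
      map_smul' := fun a h => by ext x; exact smul_comm _ _ _ } ‖g‖ fun h => by
    refine (ContinuousMap.norm_le _ (by positivity)).2 fun x => (norm_smul_le _ _).trans ?_
    exact mul_le_mul_of_nonneg_right (g.norm_coe_le_norm x) (norm_nonneg _)

theorem norm_smulConstOperator_le (g : C(X, ℂ)) :
    ‖(smulConstOperator g : H →L[ℂ] C(X, H))‖ ≤ ‖g‖ :=
  LinearMap.mkContinuous_norm_le _ (norm_nonneg g) _

end Multiplication

section Volterra

open unitInterval

theorem integrable_unitInterval_iff {X : Type*} [NormedAddCommGroup X] {f : ℝ → X} :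
    Integrable (fun t : I => f t) ↔ IntervalIntegrable f volume 0 1 := by
  rw [intervalIntegrable_iff_integrableOn_Icc_of_le zero_le_one]
  exact unitInterval.measurePreserving_coe.integrable_comp_emb unitInterval.measurableEmbedding_coe

theorem ae_unitInterval_iff {P : ℝ → Prop} :
    (∀ᵐ t : I, P t) ↔ ∀ᵐ t ∂volume.restrict (Icc (0 : ℝ) 1), P t := by
  rw [← unitInterval.measurePreserving_coe.map_eq, unitInterval.measurableEmbedding_coe.ae_map_iff]

theorem continuousMap_eq_of_ae_eq {X : Type*} [TopologicalSpace X] [T2Space X] {f g : C(I, X)}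
    (h : f =ᵐ[volume] g) : f = g := by
  have hext : ∀ᵐ t ∂volume.restrict (Icc (0 : ℝ) 1),
      f (projIcc 0 1 zero_le_one t) = g (projIcc 0 1 zero_le_one t) := by
    refine ae_unitInterval_iff.1 ?_
    simp only [projIcc_val]
    exact h
  ext t
  simpa only [projIcc_val] using Measure.eqOn_Icc_of_ae_eq volume zero_ne_one hext
    (by fun_prop) (by fun_prop) t.2

variable {κ : ℂ} {s c : ℝ → ℂ} {H : Type*} [NormedAddCommGroup H] [NormedSpace ℂ H]
  {w : I → H →L[ℂ] H}

theorem integral_unitInterval (g : ℝ → H) : ∫ t : I, g t = ∫ t in (0 : ℝ)..1, g t := by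
  rw [unitInterval.measurePreserving_coe.integral_comp unitInterval.measurableEmbedding_coe g,
    integral_Icc_eq_integral_Ioc, intervalIntegral.integral_of_le zero_le_one]

theorem integral_unitInterval_of_eq_zero {g : ℝ → H} {a : ℝ} (ha : a ∈ Icc (0 : ℝ) 1)
    (hg : ∀ t, a < t → g t = 0) : ∫ t : I, g t = ∫ t in (0 : ℝ)..a, g t := by
  rw [integral_unitInterval, intervalIntegral.integral_of_le zero_le_one,
    intervalIntegral.integral_of_le ha.1]
  exact setIntegral_eq_of_subset_of_forall_sdiff_eq_zero measurableSet_Ioc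
    (Ioc_subset_Ioc_right ha.2) fun t ht => hg t (not_le.1 fun h => ht.2 ⟨ht.1.1, h⟩)

/-- The Volterra kernel `e^{-τ(x - t)} s(x - t)`, extended by zero to `x < t`. The exponential
factor makes the kernel small when `τ` is large. -/
def IsFundamentalPair.kernel (h : IsFundamentalPair κ s c) (τ : ℝ) : C(I × I, ℂ) where
  toFun q := Real.exp (-(τ * max (q.1 - q.2 : ℝ) 0)) * s (max (q.1 - q.2) 0)
  continuous_toFun := by
    have := h.continuous_left
    fun_prop

theorem IsFundamentalPair.kernel_apply (h : IsFundamentalPair κ s c) (τ : ℝ) (x t : I) :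
    h.kernel τ (x, t) = Real.exp (-(τ * max (x - t : ℝ) 0)) * s (max (x - t) 0) := rfl

theorem IsFundamentalPair.norm_kernel_le (h : IsFundamentalPair κ s c) {τ r : ℝ} (hr : 0 < r)
    (hs : ∀ y ∈ Icc (0 : ℝ) 1, ‖s y‖ ≤ Real.exp (τ * y) / r) : ‖h.kernel τ‖ ≤ r⁻¹ := by
  refine (ContinuousMap.norm_le _ (by positivity)).2 fun ⟨x, t⟩ => ?_
  have hy : max (x - t : ℝ) 0 ∈ Icc (0 : ℝ) 1 :=
    ⟨le_max_right _ _, max_le (by linarith [x.2.2, t.2.1]) zero_le_one⟩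
  rw [h.kernel_apply, norm_mul, Complex.norm_real, Real.norm_of_nonneg (Real.exp_nonneg _)]
  calc Real.exp (-(τ * max (x - t : ℝ) 0)) * ‖s (max (x - t) 0)‖
      ≤ Real.exp (-(τ * max (x - t : ℝ) 0)) * (Real.exp (τ * max (x - t : ℝ) 0) / r) := by
        gcongr
        exact hs _ hy
    _ = r⁻¹ := by rw [← mul_div_assoc, ← Real.exp_add, neg_add_cancel, Real.exp_zero, one_div]

/-- The function `x ↦ e^{-τ x}`, by which solutions are weighted. -/
def expWeight (τ : ℝ) : C(I, ℂ) where
  toFun x := (Real.exp (-(τ * x)) : ℝ)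

theorem expWeight_mul_neg (τ : ℝ) (x : I) : expWeight τ x * expWeight (-τ) x = 1 := by
  simp only [expWeight, ContinuousMap.coe_mk]
  rw [← Complex.ofReal_mul, ← Real.exp_add, neg_mul, neg_neg, neg_add_cancel, Real.exp_zero,
    Complex.ofReal_one]

theorem IsFundamentalPair.integralOperator_kernel (h : IsFundamentalPair κ s c) (τ : ℝ)
    {w : ℝ → H →L[ℂ] H} (hw : Integrable (fun t : I => w t)) {ψ : ℝ → H} {f : C(I, H)}
    (hf : ∀ t : I, f t = expWeight τ t • ψ t) (x : I) :
    integralOperator (h.kernel τ) hw f x =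
      expWeight τ x • ∫ t in (0 : ℝ)..x, s (x - t) • w t (ψ t) := by
  have hzero (t : ℝ) (ht : (x : ℝ) < t) :
      s (max (x - t) 0) • (Real.exp (-(τ * x)) : ℂ) • w t (ψ t) = 0 := by
    rw [max_eq_right (sub_nonpos.2 ht.le), h.left_zero, zero_smul]
  rw [integralOperator_apply, ← intervalIntegral.integral_smul]
  trans ∫ t : I, s (max (x - t) 0) • (Real.exp (-(τ * x)) : ℂ) • w t (ψ t)
  · refine integral_congr_ae (Eventually.of_forall fun t => ?_)
    rcases le_total (t : ℝ) x with htx | htx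
    · have hexp : Real.exp (-(τ * (x - t))) * Real.exp (-(τ * t)) = Real.exp (-(τ * x)) := by
        rw [← Real.exp_add]
        ring_nf
      simp only [h.kernel_apply, hf, expWeight, ContinuousMap.coe_mk, map_smul, smul_smul,
        max_eq_left (sub_nonneg.2 htx), ← hexp, Complex.ofReal_mul]
      congr 1
      ring
    · simp only [h.kernel_apply, max_eq_right (sub_nonpos.2 htx), h.left_zero, mul_zero, zero_smul]
  · rw [integral_unitInterval_of_eq_zero x.2 hzero]
    refine intervalIntegral.integral_congr fun t ht => ?_
    rw [uIcc_of_le x.2.1] at ht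
    simp only [max_eq_left (sub_nonneg.2 ht.2), expWeight, ContinuousMap.coe_mk]
    exact smul_comm _ _ _

end Volterra

section SolutionOperator

open unitInterval

theorem differentiableAt_inverse_one_sub {A : Type*} [NormedRing A] [NormedAlgebra ℂ A]
    [CompleteSpace A] {a b : A} {κ lam : ℂ} (h : IsUnit (1 - (a + (κ - lam) • b))) :
    DifferentiableAt ℂ (fun lam => Ring.inverse (1 - (a + (κ - lam) • b))) lam :=
  DifferentiableAt.inverse (h := fun lam => 1 - (a + (κ - lam) • b)) (by fun_prop) h

variable {H : Type*} [NormedAddCommGroup H] [NormedSpace ℂ H] {κ lam : ℂ} {s c : ℝ → ℂ}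
  {w : ℝ → H →L[ℂ] H} {ψ p : ℝ → H} {g : C(I, H)} {τ : ℝ}

/-- `ψ` solves `ψ'' = w ψ - lam ψ` on `[0, 1]`, for an operator-valued coefficient `w`, and `p` is
the derivative of `ψ`. -/
structure IsSolutionPair (w : ℝ → H →L[ℂ] H) (lam : ℂ) (ψ p : ℝ → H) : Prop where
  isPrimitiveOn : IsPrimitiveOn ψ p 0 1
  isPrimitiveOn_deriv : IsPrimitiveOn p (fun t => w t (ψ t) - lam • ψ t) 0 1

/-- The Volterra operator of the equation `ψ'' + κ ψ = (w + κ - lam) ψ`, acting on weighted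
functions `e^{-τ x} ψ(x)`. -/
def IsFundamentalPair.volterra (h : IsFundamentalPair κ s c) (τ : ℝ)
    (hw : Integrable (fun t : I => w t)) (lam : ℂ) : C(I, H) →L[ℂ] C(I, H) :=
  integralOperator (h.kernel τ) (hw.add ((integrable_const (1 : H →L[ℂ] H)).smul (κ - lam)))

/-- The operator `h ↦ e^{-τ x} s(x) h`, the weighted solution for `w = lam - κ`. -/
def IsFundamentalPair.free (h : IsFundamentalPair κ s c) (τ : ℝ) : H →L[ℂ] C(I, H) :=
  smulConstOperator ((h.kernel τ).comp ⟨fun x => (x, 0), by fun_prop⟩)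

theorem IsFundamentalPair.free_apply (h : IsFundamentalPair κ s c) (τ : ℝ) (v : H) (x : I) :
    h.free τ v x = expWeight τ x • s x • v := by
  have hval : h.kernel τ (x, 0) = expWeight τ x * s x := by
    rw [h.kernel_apply, Icc.coe_zero, sub_zero, max_eq_left x.2.1]
    rfl
  rw [smul_smul, ← hval]
  rfl

theorem IsFundamentalPair.volterra_apply (h : IsFundamentalPair κ s c) (τ : ℝ)
    (hw : Integrable (fun t : I => w t)) (hg : ∀ t : I, g t = ψ t) (x : I) :
    h.volterra τ hw lam (mulOperator (expWeight τ) g) x =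
      expWeight τ x • ∫ t in (0 : ℝ)..x,
        s (x - t) • (w t (ψ t) - lam • ψ t + κ • ψ t) := by
  have hw' : Integrable (fun t : I => (w t + (κ - lam) • 1 : H →L[ℂ] H)) :=
    hw.add ((integrable_const (1 : H →L[ℂ] H)).smul (κ - lam))
  have hf (t : I) : mulOperator (expWeight τ) g t = expWeight τ t • ψ t := by
    rw [← hg]
    rfl
  refine (h.integralOperator_kernel τ (w := fun t => w t + (κ - lam) • 1) hw' hf x).trans ?_
  have hsplit (t : ℝ) : (w t + (κ - lam) • 1 : H →L[ℂ] H) (ψ t) =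
      w t (ψ t) - lam • ψ t + κ • ψ t := by
    rw [_root_.add_apply, _root_.smul_apply, one_apply_eq_self, sub_smul, add_sub,
      sub_add_eq_add_sub]
  simp only [hsplit]

theorem IsFundamentalPair.norm_free_le (h : IsFundamentalPair κ s c) {r : ℝ} (hr : 0 < r)
    (hs : ∀ y ∈ Icc (0 : ℝ) 1, ‖s y‖ ≤ Real.exp (τ * y) / r) :
    ‖(h.free τ : H →L[ℂ] C(I, H))‖ ≤ r⁻¹ :=
  (norm_smulConstOperator_le _).trans <| (ContinuousMap.norm_le _ (by positivity)).2 fun _ =>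
    ((h.kernel τ).norm_coe_le_norm _).trans (h.norm_kernel_le hr hs)

theorem IsFundamentalPair.norm_volterra_le (h : IsFundamentalPair κ s c)
    (hw : Integrable (fun t : I => w t)) {r : ℝ} (hr : 0 < r)
    (hs : ∀ y ∈ Icc (0 : ℝ) 1, ‖s y‖ ≤ Real.exp (τ * y) / r) :
    ‖h.volterra τ hw lam‖ ≤ r⁻¹ * ((∫ t : I, ‖w t‖) + ‖κ - lam‖) := by
  refine (norm_integralOperator_le _ _).trans (mul_le_mul (h.norm_kernel_le hr hs) ?_
    (integral_nonneg fun _ => norm_nonneg _) (by positivity))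
  have hbound (t : I) : ‖w t + (κ - lam) • (1 : H →L[ℂ] H)‖ ≤ ‖w t‖ + ‖κ - lam‖ := by
    refine (norm_add_le _ _).trans (add_le_add_right ?_ _)
    rw [norm_smul]
    exact mul_le_of_le_one_right (norm_nonneg _) ContinuousLinearMap.norm_id_le
  calc ∫ t : I, ‖w t + (κ - lam) • (1 : H →L[ℂ] H)‖
      ≤ ∫ t : I, ‖w t‖ + ‖κ - lam‖ := integral_mono
        (hw.add ((integrable_const (1 : H →L[ℂ] H)).smul (κ - lam))).norm
        (hw.norm.add (integrable_const ‖κ - lam‖)) hbound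
    _ = (∫ t : I, ‖w t‖) + ‖κ - lam‖ := by
        rw [integral_add hw.norm (integrable_const ‖κ - lam‖), integral_const, probReal_univ,
          one_smul]

theorem IsFundamentalPair.volterra_eq_add_smul (h : IsFundamentalPair κ s c)
    (hw : Integrable (fun t : I => w t)) :
    h.volterra τ hw lam = integralOperator (h.kernel τ) hw + (κ - lam) •
      integralOperator (h.kernel τ) (μ := (volume : Measure I))
        (integrable_const (1 : H →L[ℂ] H)) :=
  integralOperator_add_smul _ _ _ _

theorem expWeight_smul_injective (τ : ℝ) :
    Function.Injective (mulOperator (H := H) (expWeight τ)) := fun f f' h => by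
  ext x
  have hx : expWeight τ x • f x = expWeight τ x • f' x := congrArg (fun k : C(I, H) => k x) h
  exact smul_right_injective H (left_ne_zero_of_mul_eq_one (expWeight_mul_neg τ x)) hx

theorem mulOperator_expWeight_mul_neg (τ : ℝ) (f : C(I, H)) :
    mulOperator (expWeight τ) (mulOperator (expWeight (-τ)) f) = f := by
  ext x
  change expWeight τ x • expWeight (-τ) x • f x = f x
  rw [smul_smul, expWeight_mul_neg, one_smul]

theorem norm_volterra_zero_lt_one (hw : Integrable (fun t : I => w t))
    (hτ : (∫ t : I, ‖w t‖) + ‖lam‖ < τ) : ‖isFundamentalPair_zero.volterra τ hw lam‖ < 1 := by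
  have hτ0 : 0 < τ := lt_of_le_of_lt (by positivity) hτ
  refine (isFundamentalPair_zero.norm_volterra_le hw hτ0 fun y hy => ?_).trans_lt ?_
  · rw [Complex.norm_real, Real.norm_of_nonneg hy.1, le_div_iff₀ hτ0, mul_comm]
    exact (lt_add_one _).le.trans (Real.add_one_le_exp _)
  · rwa [zero_sub, norm_neg, inv_mul_lt_one₀ hτ0]

variable [CompleteSpace H]

theorem IsSolutionPair.weighted_eq (hψ : IsSolutionPair w lam ψ p) (h : IsFundamentalPair κ s c)
    (τ : ℝ) (hw : Integrable (fun t : I => w t)) (h0 : ψ 0 = 0) (hg : ∀ t : I, g t = ψ t) :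
    mulOperator (expWeight τ) g =
      h.free τ (p 0) + h.volterra τ hw lam (mulOperator (expWeight τ) g) := by
  ext x
  have hx : (x : ℝ) ∈ uIcc (0 : ℝ) 1 := by
    rw [uIcc_of_le zero_le_one]
    exact x.2
  have hval : mulOperator (expWeight τ) g x = expWeight τ x • ψ x := by
    rw [← hg]
    rfl
  rw [hval, h.variation_of_parameters (hψ.isPrimitiveOn.mono_right hx)
    (hψ.isPrimitiveOn_deriv.mono_right hx), h0, smul_zero, zero_add, smul_add,
    ContinuousMap.add_apply, h.free_apply, h.volterra_apply τ hw hg]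

theorem isSolutionPair_of_weighted_eq (hw : Integrable (fun t : I => w t)) {v : H}
    (hfix : mulOperator (expWeight τ) g = isFundamentalPair_zero.free τ v +
      isFundamentalPair_zero.volterra τ hw lam (mulOperator (expWeight τ) g)) :
    ∃ p, IsSolutionPair w lam (fun x => g (projIcc 0 1 zero_le_one x)) p ∧ g 0 = 0 ∧ p 0 = v := by
  set ψ : ℝ → H := fun x => g (projIcc 0 1 zero_le_one x)
  have hψ (t : I) : g t = ψ t := by simp only [ψ, projIcc_val]
  have hq : IntervalIntegrable (fun t => w t (ψ t) - lam • ψ t) volume 0 1 := by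
    refine integrable_unitInterval_iff.1 ?_
    simp only [← hψ]
    exact (integrable_clm_apply hw g).sub
      ((integrable_clm_apply (integrable_const (1 : H →L[ℂ] H)) g).smul lam)
  set p : ℝ → H := fun x => v + ∫ t in (0 : ℝ)..x, w t (ψ t) - lam • ψ t
  have hp0 : p 0 = v := by simp only [p, intervalIntegral.integral_same, add_zero]
  have hp : IsPrimitiveOn p (fun t => w t (ψ t) - lam • ψ t) 0 1 := ⟨hq, fun x _ => by rw [hp0]⟩
  have hdouble : IsPrimitiveOn (fun x => ∫ t in (0 : ℝ)..x, p t) p 0 1 :=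
    ⟨hp.continuousOn.intervalIntegrable, fun x _ => by
      rw [intervalIntegral.integral_same, zero_add]⟩
  have heq (x : ℝ) (hx : x ∈ uIcc (0 : ℝ) 1) : ψ x = ∫ t in (0 : ℝ)..x, p t := by
    have hvar := isFundamentalPair_zero.variation_of_parameters (hdouble.mono_right hx)
      (hp.mono_right hx)
    rw [uIcc_of_le zero_le_one] at hx
    have hval := congrArg (fun k : C(I, H) => k ⟨x, hx⟩) hfix
    rw [ContinuousMap.add_apply, isFundamentalPair_zero.free_apply,
      isFundamentalPair_zero.volterra_apply τ hw hψ, ← smul_add] at hval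
    have := smul_right_injective H
      (left_ne_zero_of_mul_eq_one (expWeight_mul_neg τ ⟨x, hx⟩)) hval
    simp only [hp0, intervalIntegral.integral_same, smul_zero, zero_add, zero_smul, add_zero]
      at hvar this
    rw [hvar, ← this, hψ]
  have hψ0 : ψ 0 = 0 := by rw [heq 0 left_mem_uIcc, intervalIntegral.integral_same]
  exact ⟨p, ⟨⟨hdouble.intervalIntegrable, fun x hx => by rw [hψ0, zero_add, heq x hx]⟩, hp⟩,
    (hψ 0).trans hψ0, hp0⟩

/-- The operator that sends `v` to the solution of `ψ'' = w ψ - lam ψ` with `ψ(0) = 0` and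
`ψ'(0) = v`, provided `τ` is so large that the Volterra operator is a contraction. -/
def weightedSolution (hw : Integrable (fun t : I => w t)) (τ : ℝ) (lam : ℂ) : H →L[ℂ] C(I, H) :=
  mulOperator (expWeight (-τ)) ∘L
    Ring.inverse (1 - isFundamentalPair_zero.volterra τ hw lam) ∘L isFundamentalPair_zero.free τ

theorem weightedSolution_fixed (hw : Integrable (fun t : I => w t))
    (hτ : (∫ t : I, ‖w t‖) + ‖lam‖ < τ) (v : H) :
    mulOperator (expWeight τ) (weightedSolution hw τ lam v) = isFundamentalPair_zero.free τ v +
      isFundamentalPair_zero.volterra τ hw lam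
        (mulOperator (expWeight τ) (weightedSolution hw τ lam v)) := by
  set T := isFundamentalPair_zero.volterra τ hw lam
  have hunit : IsUnit (1 - T) := isUnit_one_sub_of_norm_lt_one (R := C(I, H) →L[ℂ] C(I, H))
    (norm_volterra_zero_lt_one hw hτ)
  have hcancel : (1 - T) (Ring.inverse (1 - T) (isFundamentalPair_zero.free τ v)) =
      isFundamentalPair_zero.free τ v :=
    congrArg (fun A : C(I, H) →L[ℂ] C(I, H) => A (isFundamentalPair_zero.free τ v))
      (Ring.mul_inverse_cancel _ hunit)
  have hmul : mulOperator (expWeight τ) (weightedSolution hw τ lam v) =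
      Ring.inverse (1 - T) (isFundamentalPair_zero.free τ v) := mulOperator_expWeight_mul_neg τ _
  rw [hmul]
  exact sub_eq_iff_eq_add.1 hcancel

theorem IsSolutionPair.eq_weightedSolution (hψ : IsSolutionPair w lam ψ p)
    (hw : Integrable (fun t : I => w t)) (hτ : (∫ t : I, ‖w t‖) + ‖lam‖ < τ) (h0 : ψ 0 = 0)
    (hg : ∀ t : I, g t = ψ t) : g = weightedSolution hw τ lam (p 0) := by
  have hfix := hψ.weighted_eq isFundamentalPair_zero τ hw h0 hg
  have hfix' := weightedSolution_fixed hw hτ (p 0)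
  set T := isFundamentalPair_zero.volterra τ hw lam
  have hunit : IsUnit (1 - T) := isUnit_one_sub_of_norm_lt_one (R := C(I, H) →L[ℂ] C(I, H))
    (norm_volterra_zero_lt_one hw hτ)
  refine expWeight_smul_injective τ
    ((ContinuousLinearMap.isUnit_iff_bijective.1 hunit).injective ?_)
  exact (sub_eq_iff_eq_add.2 hfix).trans (sub_eq_iff_eq_add.2 hfix').symm

theorem differentiableAt_weightedSolution (hw : Integrable (fun t : I => w t))
    (hτ : (∫ t : I, ‖w t‖) + ‖lam‖ < τ) :
    DifferentiableAt ℂ (fun lam => weightedSolution hw τ lam) lam := by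
  have hunit : IsUnit (1 - isFundamentalPair_zero.volterra τ hw lam) :=
    isUnit_one_sub_of_norm_lt_one (R := C(I, H) →L[ℂ] C(I, H))
      (norm_volterra_zero_lt_one hw hτ)
  have hinv : DifferentiableAt ℂ
      (fun lam => Ring.inverse (1 - isFundamentalPair_zero.volterra τ hw lam)) lam := by
    simp only [isFundamentalPair_zero.volterra_eq_add_smul hw] at hunit ⊢
    exact differentiableAt_inverse_one_sub (A := C(I, H) →L[ℂ] C(I, H)) hunit
  exact (differentiableAt_const _).clm_comp (hinv.clm_comp (differentiableAt_const _))

/-- The operator `φ` that sends `v` to the solution of `ψ'' = w ψ - lam ψ` on `[0, 1]` with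
`ψ(0) = 0` and `ψ'(0) = v`. -/
def dirichletSolution (hw : Integrable (fun t : I => w t)) (lam : ℂ) : H →L[ℂ] C(I, H) :=
  weightedSolution hw ((∫ t : I, ‖w t‖) + ‖lam‖ + 1) lam

theorem exists_isSolutionPair_dirichletSolution (hw : Integrable (fun t : I => w t)) (lam : ℂ)
    (v : H) :
    ∃ p, IsSolutionPair w lam
      (fun x => dirichletSolution hw lam v (projIcc 0 1 zero_le_one x)) p ∧
      dirichletSolution hw lam v 0 = 0 ∧ p 0 = v :=
  isSolutionPair_of_weighted_eq hw (weightedSolution_fixed hw (lt_add_one _) v)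

theorem IsSolutionPair.eq_dirichletSolution (hψ : IsSolutionPair w lam ψ p)
    (hw : Integrable (fun t : I => w t)) (h0 : ψ 0 = 0) (x : I) :
    ψ x = dirichletSolution hw lam (p 0) x := by
  have hψc : ContinuousOn ψ (Icc 0 1) := by
    rw [← uIcc_of_le zero_le_one]
    exact hψ.isPrimitiveOn.continuousOn
  exact congrArg (fun k : C(I, H) => k x) (hψ.eq_weightedSolution hw
    (g := ⟨_, hψc.domRestrict⟩) (lt_add_one _) h0 fun t => rfl)

theorem dirichletSolution_eq_weightedSolution (hw : Integrable (fun t : I => w t))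
    (hτ : (∫ t : I, ‖w t‖) + ‖lam‖ < τ) :
    dirichletSolution hw lam = weightedSolution hw τ lam := by
  ext1 v
  obtain ⟨p, hp, h0, rfl⟩ := exists_isSolutionPair_dirichletSolution hw lam v
  refine hp.eq_weightedSolution hw hτ ?_ fun t => by rw [projIcc_val]
  rw [projIcc_left]
  exact h0

theorem differentiable_dirichletSolution (hw : Integrable (fun t : I => w t)) :
    Differentiable ℂ (dirichletSolution hw) := fun lam => by
  have hnhds : ∀ᶠ lam' in 𝓝 lam, (∫ t : I, ‖w t‖) + ‖lam'‖ < (∫ t : I, ‖w t‖) + ‖lam‖ + 1 :=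
    (by fun_prop : Continuous fun lam' : ℂ => (∫ t : I, ‖w t‖) + ‖lam'‖).continuousAt.eventually_lt
      continuousAt_const (lt_add_one _)
  exact (differentiableAt_weightedSolution hw (lt_add_one _)).congr_of_eventuallyEq
    (hnhds.mono fun lam' h => dirichletSolution_eq_weightedSolution hw h)

end SolutionOperator

section BoundaryValues

open unitInterval

variable {H : Type*} [NormedAddCommGroup H] [NormedSpace ℂ H] [CompleteSpace H] {lam : ℂ}
  {w : ℝ → H →L[ℂ] H} {ψ p : ℝ → H}

/-- The operator `φ(1, lam)`, the value at `1` of `dirichletSolution`. -/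
def dirichletValue (hw : Integrable (fun t : I => w t)) (lam : ℂ) : H →L[ℂ] H :=
  ContinuousMap.evalCLM ℂ 1 ∘L dirichletSolution hw lam

/-- The operator `φ'(1, lam)`, the derivative at `1` of `dirichletSolution`, obtained by integrating
the equation. -/
def dirichletDeriv (hw : Integrable (fun t : I => w t)) (lam : ℂ) : H →L[ℂ] H :=
  1 + ContinuousMap.evalCLM ℂ 1 ∘L integralOperator (ContinuousMap.const (I × I) 1)
    (hw.add ((integrable_const (1 : H →L[ℂ] H)).smul (-lam))) ∘L dirichletSolution hw lam

theorem differentiable_dirichletValue (hw : Integrable (fun t : I => w t)) :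
    Differentiable ℂ (dirichletValue hw) :=
  (differentiable_const _).clm_comp (differentiable_dirichletSolution hw)

theorem IsSolutionPair.deriv_one (hψ : IsSolutionPair w lam ψ p)
    (hw : Integrable (fun t : I => w t)) (h0 : ψ 0 = 0) : p 1 = dirichletDeriv hw lam (p 0) := by
  have happly (t : I) : (w t + (-lam) • (1 : H →L[ℂ] H)) (dirichletSolution hw lam (p 0) t) =
      w t (ψ t) - lam • ψ t := by
    rw [← hψ.eq_dirichletSolution hw h0, _root_.add_apply, _root_.smul_apply, one_apply_eq_self,
      neg_smul, sub_eq_add_neg]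
  rw [hψ.isPrimitiveOn_deriv.eq_add_integral 1 right_mem_uIcc, ← integral_unitInterval]
  refine congrArg (p 0 + ·) (integral_congr_ae (Eventually.of_forall fun t => ?_))
  exact (happly t).symm.trans (one_smul ℂ _).symm

theorem exists_isSolutionPair (hw : Integrable (fun t : I => w t)) (lam : ℂ) (v : H) :
    ∃ ψ p, IsSolutionPair w lam ψ p ∧ ψ 0 = 0 ∧ p 0 = v := by
  obtain ⟨p, hp, h0, hv⟩ := exists_isSolutionPair_dirichletSolution hw lam v
  refine ⟨_, p, hp, ?_, hv⟩
  rw [projIcc_left]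
  exact h0

theorem dirichletSolution_injective (hw : Integrable (fun t : I => w t)) (lam : ℂ) :
    Function.Injective (dirichletSolution hw lam) := by
  refine (injective_iff_map_eq_zero _).2 fun v hv => ?_
  have hfix := weightedSolution_fixed hw (lt_add_one ((∫ t : I, ‖w t‖) + ‖lam‖)) v
  change weightedSolution hw _ lam v = 0 at hv
  rw [hv, map_zero, map_zero, add_zero] at hfix
  have hone := congrArg (fun k : C(I, H) => k 1) hfix.symm
  simp only [isFundamentalPair_zero.free_apply, ContinuousMap.zero_apply, Icc.coe_one,
    Complex.ofReal_one, one_smul] at hone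
  exact (smul_eq_zero_iff_right (left_ne_zero_of_mul_eq_one (expWeight_mul_neg _ 1))).1 hone

end BoundaryValues

section Lagrange

open unitInterval

variable {H : Type*} [NormedAddCommGroup H] [InnerProductSpace ℂ H] {lam mu : ℂ}
  {w : ℝ → H →L[ℂ] H} {ψ p χ q : ℝ → H}

/-- `dirichletSolution` as an operator into `L²`. -/
def dirichletL2 (hw : Integrable (fun t : I => w t)) (lam : ℂ) :
    H →L[ℂ] Lp H 2 (volume : Measure I) :=
  ContinuousMap.toLp 2 volume ℂ ∘L dirichletSolution hw lam

theorem inner_dirichletL2 (hw : Integrable (fun t : I => w t)) (a b : H) :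
    inner ℂ (dirichletL2 hw mu a) (dirichletL2 hw lam b) =
      ∫ t : I, inner ℂ (dirichletSolution hw mu a t) (dirichletSolution hw lam b t) := by
  refine integral_congr_ae ?_
  filter_upwards [(dirichletSolution hw mu a).coeFn_toLp (p := 2) (𝕜 := ℂ) volume,
    (dirichletSolution hw lam b).coeFn_toLp (p := 2) (𝕜 := ℂ) volume] with t ha hb
  exact congrArg₂ (inner ℂ) ha hb

variable [CompleteSpace H]

theorem IsSolutionPair.lagrange (hsymm : ∀ᵐ t : I, (w t : H →ₗ[ℂ] H).IsSymmetric)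
    (hψ : IsSolutionPair w mu ψ p) (hχ : IsSolutionPair w lam χ q) (hψ0 : ψ 0 = 0)
    (hχ0 : χ 0 = 0) :
    inner ℂ (ψ 1) (q 1) - inner ℂ (p 1) (χ 1) =
      (star mu - lam) * ∫ t in (0 : ℝ)..1, inner ℂ (ψ t) (χ t) := by
  have hβ : IsBoundedBilinearMap ℝ fun q : H × H => inner ℂ q.1 q.2 := isBoundedBilinearMap_inner
  have hψq := hψ.isPrimitiveOn.bilinear hβ hχ.isPrimitiveOn_deriv
  have hpχ := hψ.isPrimitiveOn_deriv.bilinear hβ hχ.isPrimitiveOn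
  rw [hψq.eq_add_integral 1 right_mem_uIcc, hpχ.eq_add_integral 1 right_mem_uIcc, hψ0, hχ0,
    inner_zero_left, inner_zero_right, zero_add, zero_add,
    ← intervalIntegral.integral_sub hψq.intervalIntegrable hpχ.intervalIntegrable,
    ← intervalIntegral.integral_const_mul]
  refine intervalIntegral.integral_congr_ae_restrict ?_
  rw [uIoc_of_le zero_le_one]
  filter_upwards [ae_restrict_of_ae_restrict_of_subset Ioc_subset_Icc_self
    ((ae_unitInterval_iff (P := fun t => (w t : H →ₗ[ℂ] H).IsSymmetric)).1 hsymm)] with t ht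
  have hwt : inner ℂ (w t (ψ t)) (χ t) = inner ℂ (ψ t) (w t (χ t)) := ht (ψ t) (χ t)
  simp only [inner_sub_left, inner_sub_right, inner_smul_left, inner_smul_right, hwt,
    starRingEnd_apply]
  ring

theorem continuous_dirichletL2 (hw : Integrable (fun t : I => w t)) :
    Continuous (dirichletL2 hw) :=
  (differentiable_dirichletSolution hw).continuous.const_clm_comp _

theorem dirichletL2_injective (hw : Integrable (fun t : I => w t)) (lam : ℂ) :
    Function.Injective (dirichletL2 hw lam) :=
  fun a b hab => dirichletSolution_injective hw lam <| continuousMap_eq_of_ae_eq <|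
    ((dirichletSolution hw lam a).coeFn_toLp (p := 2) (𝕜 := ℂ) volume).symm.trans <|
      (congrArg (fun f : Lp H 2 (volume : Measure I) => (f : I → H)) hab ▸
        (dirichletSolution hw lam b).coeFn_toLp (p := 2) (𝕜 := ℂ) volume)

theorem lagrange (hw : Integrable (fun t : I => w t))
    (hsymm : ∀ᵐ t : I, (w t : H →ₗ[ℂ] H).IsSymmetric) (a b : H) :
    inner ℂ (dirichletValue hw mu a) (dirichletDeriv hw lam b) -
        inner ℂ (dirichletDeriv hw mu a) (dirichletValue hw lam b) =
      (star mu - lam) * inner ℂ (dirichletL2 hw mu a) (dirichletL2 hw lam b) := by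
  obtain ⟨ψ, p, hψ, hψ0, rfl⟩ := exists_isSolutionPair hw mu a
  obtain ⟨χ, q, hχ, hχ0, rfl⟩ := exists_isSolutionPair hw lam b
  have hψ1 : ψ 1 = dirichletValue hw mu (p 0) := hψ.eq_dirichletSolution hw hψ0 1
  have hχ1 : χ 1 = dirichletValue hw lam (q 0) := hχ.eq_dirichletSolution hw hχ0 1
  rw [← hψ1, ← hχ1, ← hψ.deriv_one hw hψ0, ← hχ.deriv_one hw hχ0, inner_dirichletL2,
    hψ.lagrange hsymm hχ hψ0 hχ0]
  simp only [← hψ.eq_dirichletSolution hw hψ0, ← hχ.eq_dirichletSolution hw hχ0]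
  rw [integral_unitInterval fun t => inner ℂ (ψ t) (χ t)]

end Lagrange

section Asymptotics

open unitInterval

theorem norm_sin_le_exp (z : ℂ) : ‖Complex.sin z‖ ≤ Real.exp |z.im| := by
  rw [Complex.sin, norm_div, norm_mul, Complex.norm_I, mul_one, Complex.norm_ofNat,
    div_le_iff₀ two_pos]
  refine (norm_sub_le _ _).trans ?_
  rw [Complex.norm_exp, Complex.norm_exp]
  have hneg : (-z * Complex.I).re ≤ |z.im| := by simpa using le_abs_self _
  have hpos : (z * Complex.I).re ≤ |z.im| := by simpa using neg_le_abs _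
  linarith [Real.exp_le_exp.2 hneg, Real.exp_le_exp.2 hpos]

theorem norm_sin_mul_div_le (z : ℂ) {y : ℝ} (hy : 0 ≤ y) :
    ‖Complex.sin (z * y) / z‖ ≤ Real.exp (|z.im| * y) / ‖z‖ := by
  rw [norm_div]
  gcongr
  refine (norm_sin_le_exp _).trans_eq ?_
  rw [Complex.im_mul_ofReal, abs_mul, abs_of_nonneg hy]

variable {H : Type*} [NormedAddCommGroup H] [NormedSpace ℂ H]
  {w : ℝ → H →L[ℂ] H} {z : ℂ}

theorem norm_volterra_sq_le (hw : Integrable (fun t : I => w t)) (hz : z ≠ 0) :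
    ‖(isFundamentalPair_sq hz).volterra |z.im| hw (z ^ 2)‖ ≤ (∫ t : I, ‖w t‖) / ‖z‖ := by
  have h := (isFundamentalPair_sq hz).norm_volterra_le (lam := z ^ 2) hw (norm_pos_iff.2 hz)
    fun y hy => norm_sin_mul_div_le z hy.1
  rwa [sub_self, norm_zero, add_zero, inv_mul_eq_div] at h

theorem norm_apply_one_le (τ : ℝ) (f : C(I, H)) :
    ‖f 1‖ ≤ Real.exp τ * ‖mulOperator (expWeight τ) f‖ := by
  have hone : f 1 = (Real.exp τ : ℂ) • mulOperator (expWeight τ) f 1 := by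
    change f 1 = (Real.exp τ : ℂ) • (Real.exp (-(τ * (1 : I))) : ℂ) • f 1
    rw [smul_smul, ← Complex.ofReal_mul, ← Real.exp_add, Icc.coe_one, mul_one, add_neg_cancel,
      Real.exp_zero, Complex.ofReal_one, one_smul]
  rw [hone, norm_smul, Complex.norm_real, Real.norm_of_nonneg (Real.exp_nonneg τ)]
  gcongr
  exact ContinuousMap.norm_coe_le_norm _ _

variable [CompleteSpace H]

theorem weighted_dirichletSolution_sq (hw : Integrable (fun t : I => w t)) (hz : z ≠ 0) (v : H) :
    mulOperator (expWeight |z.im|) (dirichletSolution hw (z ^ 2) v) =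
      (isFundamentalPair_sq hz).free |z.im| v + (isFundamentalPair_sq hz).volterra |z.im| hw (z ^ 2)
        (mulOperator (expWeight |z.im|) (dirichletSolution hw (z ^ 2) v)) := by
  obtain ⟨ψ, p, hψ, h0, rfl⟩ := exists_isSolutionPair hw (z ^ 2) v
  exact hψ.weighted_eq _ _ hw h0 fun t => (hψ.eq_dirichletSolution hw h0 t).symm

theorem norm_weighted_dirichletSolution_sq_le (hw : Integrable (fun t : I => w t)) (hz : z ≠ 0)
    (hzw : 2 * (∫ t : I, ‖w t‖) ≤ ‖z‖) (v : H) :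
    ‖mulOperator (expWeight |z.im|) (dirichletSolution hw (z ^ 2) v)‖ ≤ 2 * ‖v‖ / ‖z‖ := by
  have hfix := weighted_dirichletSolution_sq hw hz v
  set f := mulOperator (expWeight |z.im|) (dirichletSolution hw (z ^ 2) v)
  have hfree : ‖(isFundamentalPair_sq hz).free |z.im| v‖ ≤ ‖z‖⁻¹ * ‖v‖ :=
    ContinuousLinearMap.le_of_opNorm_le _ ((isFundamentalPair_sq hz).norm_free_le
      (norm_pos_iff.2 hz) fun y hy => norm_sin_mul_div_le z hy.1) v
  have hhalf : (∫ t : I, ‖w t‖) / ‖z‖ ≤ 1 / 2 := by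
    rw [div_le_div_iff₀ (norm_pos_iff.2 hz) two_pos]
    linarith
  have hvolt : ‖(isFundamentalPair_sq hz).volterra |z.im| hw (z ^ 2) f‖ ≤ 1 / 2 * ‖f‖ :=
    ContinuousLinearMap.le_of_opNorm_le _ ((norm_volterra_sq_le hw hz).trans hhalf) f
  have hf : ‖f‖ ≤ ‖z‖⁻¹ * ‖v‖ + 1 / 2 * ‖f‖ :=
    (congrArg norm hfix).trans_le (norm_add_le_of_le hfree hvolt)
  rw [mul_div_assoc, ← inv_mul_eq_div]
  linarith

theorem norm_dirichletValue_sq_le (hw : Integrable (fun t : I => w t)) (hz : z ≠ 0)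
    (hzw : 2 * (∫ t : I, ‖w t‖) ≤ ‖z‖) :
    ‖dirichletValue hw (z ^ 2)‖ ≤ 2 * Real.exp |z.im| / ‖z‖ := by
  refine ContinuousLinearMap.opNorm_le_bound _ (by positivity) fun v => ?_
  calc ‖dirichletValue hw (z ^ 2) v‖
      ≤ Real.exp |z.im| * ‖mulOperator (expWeight |z.im|) (dirichletSolution hw (z ^ 2) v)‖ :=
        norm_apply_one_le |z.im| (dirichletSolution hw (z ^ 2) v)
    _ ≤ Real.exp |z.im| * (2 * ‖v‖ / ‖z‖) := by
        gcongr
        exact norm_weighted_dirichletSolution_sq_le hw hz hzw v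
    _ = 2 * Real.exp |z.im| / ‖z‖ * ‖v‖ := by ring

theorem norm_dirichletValue_sq_sub_le (hw : Integrable (fun t : I => w t)) (hz : z ≠ 0)
    (hzw : 2 * (∫ t : I, ‖w t‖) ≤ ‖z‖) :
    ‖dirichletValue hw (z ^ 2) - (Complex.sin z / z) • (1 : H →L[ℂ] H)‖ ≤
      2 * (∫ t : I, ‖w t‖) * Real.exp |z.im| / ‖z‖ ^ 2 := by
  refine ContinuousLinearMap.opNorm_le_bound _ (by positivity) fun v => ?_
  set f := mulOperator (expWeight |z.im|) (dirichletSolution hw (z ^ 2) v)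
  set u := (isFundamentalPair_sq hz).free |z.im| v
  set g : C(I, H) := dirichletSolution hw (z ^ 2) v - mulOperator (expWeight (-|z.im|)) u
  have hg : mulOperator (expWeight |z.im|) g =
      (isFundamentalPair_sq hz).volterra |z.im| hw (z ^ 2) f := by
    rw [map_sub, mulOperator_expWeight_mul_neg]
    exact sub_eq_iff_eq_add'.2 (weighted_dirichletSolution_sq hw hz v)
  have hu : mulOperator (expWeight (-|z.im|)) u 1 = (Complex.sin z / z) • v := by
    change expWeight (-|z.im|) 1 • u 1 = _
    rw [(isFundamentalPair_sq hz).free_apply, smul_smul, mul_comm, expWeight_mul_neg, one_smul,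
      Icc.coe_one, Complex.ofReal_one, mul_one]
  have hone : (dirichletValue hw (z ^ 2) - (Complex.sin z / z) • (1 : H →L[ℂ] H)) v = g 1 :=
    congrArg (dirichletSolution hw (z ^ 2) v 1 - ·) hu.symm
  calc ‖(dirichletValue hw (z ^ 2) - (Complex.sin z / z) • (1 : H →L[ℂ] H)) v‖
      ≤ Real.exp |z.im| * ‖(isFundamentalPair_sq hz).volterra |z.im| hw (z ^ 2) f‖ := by
        rw [hone, ← hg]
        exact norm_apply_one_le _ _
    _ ≤ Real.exp |z.im| * ((∫ t : I, ‖w t‖) / ‖z‖ * (2 * ‖v‖ / ‖z‖)) := by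
        gcongr
        exact ContinuousLinearMap.le_of_opNorm_le_of_le _ (norm_volterra_sq_le hw hz)
          (norm_weighted_dirichletSolution_sq_le hw hz hzw v)
    _ = 2 * (∫ t : I, ‖w t‖) * Real.exp |z.im| / ‖z‖ ^ 2 * ‖v‖ := by ring

end Asymptotics

section SimplePole

open Asymptotics

variable {E : Type*} [NormedAddCommGroup E] [NormedSpace ℂ E]

/-- The inverse of the operator function `A` has at most a simple pole at `mu`; `A` may vanish at
`mu` itself, so only punctured neighbourhoods matter. -/
structure HasSimplePoleInverse (A : ℂ → E →L[ℂ] E) (mu : ℂ) : Prop where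
  eventually_isUnit : ∀ᶠ lam in 𝓝[≠] mu, IsUnit (A lam)
  isBigO : (fun lam => Ring.inverse (A lam)) =O[𝓝[≠] mu] fun lam => (lam - mu)⁻¹

theorem one_isBigO_inv_sub (mu : ℂ) :
    (fun _ => (1 : ℂ)) =O[𝓝[≠] mu] fun lam => (lam - mu)⁻¹ := by
  have hsub : (fun lam : ℂ => lam - mu) =O[𝓝[≠] mu] fun _ => (1 : ℂ) :=
    ((by fun_prop : Continuous fun lam : ℂ => lam - mu).tendsto mu).isBigO_one ℂ |>.mono
      nhdsWithin_le_nhds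
  simpa only [inv_one] using hsub.inv_rev
    (eventually_mem_nhdsWithin.mono fun lam hne h => absurd (sub_eq_zero.1 h) hne)

theorem eventually_isUnit_of_continuousAt [CompleteSpace E] {A : ℂ → E →L[ℂ] E} {mu : ℂ}
    (hA : ContinuousAt A mu) (hunit : IsUnit (A mu)) : ∀ᶠ lam in 𝓝 mu, IsUnit (A lam) :=
  hA.eventually (hunit.unit.nhds)

theorem inverse_isBigO_one [CompleteSpace E] {A : ℂ → E →L[ℂ] E} {mu : ℂ}
    (hA : ContinuousAt A mu) (hunit : IsUnit (A mu)) :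
    (fun lam => Ring.inverse (A lam)) =O[𝓝[≠] mu] fun _ => (1 : ℂ) :=
  ((ContinuousAt.comp (f := A) (NormedRing.inverse_continuousAt hunit.unit) hA).tendsto.isBigO_one
    ℂ).mono nhdsWithin_le_nhds

theorem hasSimplePoleInverse_of_isUnit [CompleteSpace E] {A : ℂ → E →L[ℂ] E} {mu : ℂ}
    (hA : ContinuousAt A mu) (hunit : IsUnit (A mu)) : HasSimplePoleInverse A mu :=
  ⟨nhdsWithin_le_nhds (eventually_isUnit_of_continuousAt hA hunit),
    (inverse_isBigO_one hA hunit).trans (one_isBigO_inv_sub mu)⟩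

variable [FiniteDimensional ℂ E]

theorem isUnit_of_injective {A : E →L[ℂ] E} (hA : Function.Injective A) : IsUnit A :=
  ContinuousLinearMap.isUnit_iff_bijective.2 ⟨hA, LinearMap.injective_iff_surjective.1 hA⟩

theorem hasSimplePoleInverse_of_eq_mul {A L C : ℂ → E →L[ℂ] E} {mu : ℂ}
    (hC : ContinuousAt C mu) (hunit : IsUnit (C mu))
    (hL : L =O[𝓝[≠] mu] fun lam => (lam - mu)⁻¹) (hfac : ∀ᶠ lam in 𝓝[≠] mu, C lam = L lam * A lam) :
    HasSimplePoleInverse A mu := by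
  have : CompleteSpace E := FiniteDimensional.complete ℂ E
  have hleft : ∀ᶠ lam in 𝓝[≠] mu, Ring.inverse (C lam) * L lam * A lam = 1 := by
    filter_upwards [hfac, nhdsWithin_le_nhds (eventually_isUnit_of_continuousAt hC hunit)]
      with lam hlam hu
    rw [mul_assoc, ← hlam, Ring.inverse_mul_cancel _ hu]
  have hA : ∀ᶠ lam in 𝓝[≠] mu, IsUnit (A lam) := hleft.mono fun lam h =>
    isUnit_of_injective (Function.LeftInverse.injective (g := Ring.inverse (C lam) * L lam)
      fun x => congrArg (fun T : E →L[ℂ] E => T x) h)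
  refine ⟨hA, IsBigO.congr' (((inverse_isBigO_one hC hunit).mul hL)) ?_
    (Eventually.of_forall fun _ => one_mul _)⟩
  filter_upwards [hleft, hA] with lam h hu
  rw [← Ring.mul_inverse_cancel_right (A lam) (Ring.inverse (C lam) * L lam) hu, h, one_mul]

end SimplePole

section SimplePoleOfInner

variable {E K : Type*} [NormedAddCommGroup E] [InnerProductSpace ℂ E] [CompleteSpace E]
  [NormedAddCommGroup K] [InnerProductSpace ℂ K] [CompleteSpace K]

open Asymptotics ContinuousLinearMap

theorem starProjection_ker_mul_eq {A B D : E →L[ℂ] E} {U V : E →L[ℂ] K} {ζ : ℂ}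
    (hζ : ζ ≠ 0) (h : ∀ a, A a = 0 → ∀ b, inner ℂ (D a) (B b) = ζ * inner ℂ (U a) (V b)) :
    A.ker.starProjection * (adjoint U ∘L V) =
      ζ⁻¹ • (adjoint (D * A.ker.starProjection) * B) := by
  rw [eq_inv_smul_iff₀ hζ]
  ext1 b
  refine ext_inner_left ℂ fun a => ?_
  calc inner ℂ a (ζ • A.ker.starProjection (adjoint U (V b)))
      = ζ * inner ℂ (U (A.ker.starProjection a)) (V b) := by
        rw [inner_smul_right, ← A.ker.inner_starProjection_left_eq_right, adjoint_inner_right]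
    _ = inner ℂ (D (A.ker.starProjection a)) (B b) :=
        (h _ (A.ker.starProjection_apply_mem _) b).symm
    _ = inner ℂ a (adjoint (D * A.ker.starProjection) (B b)) :=
        (adjoint_inner_right (D * A.ker.starProjection) a (B b)).symm

variable [FiniteDimensional ℂ E]

theorem isUnit_adjoint_mul_add (A : E →L[ℂ] E) {U : E →L[ℂ] K} (hU : Function.Injective U) :
    IsUnit (adjoint A * A + A.ker.starProjection * (adjoint U ∘L U)) := by
  refine isUnit_of_injective ((injective_iff_map_eq_zero _).2 fun x hx => ?_)
  set P := A.ker.starProjection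
  set y := P (adjoint U (U x))
  have hy : A y = 0 := A.ker.starProjection_apply_mem _
  have hsum : adjoint A (A x) + y = 0 := hx
  have hy0 : y = 0 := by
    have h := congrArg (inner ℂ y) hsum
    rw [inner_add_right, adjoint_inner_right, hy, inner_zero_left, zero_add, inner_zero_right] at h
    exact inner_self_eq_zero.1 h
  have hAx : A x = 0 := by
    have h := congrArg (inner ℂ x) hsum
    rw [hy0, add_zero, adjoint_inner_right, inner_zero_right] at h
    exact inner_self_eq_zero.1 h
  have hUx : U x = 0 := by
    have h : inner ℂ x y = inner ℂ (P x) (adjoint U (U x)) :=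
      (A.ker.inner_starProjection_left_eq_right _ _).symm
    rw [hy0, inner_zero_right, Submodule.starProjection_eq_self_iff.2 hAx, adjoint_inner_right] at h
    exact inner_self_eq_zero.1 h.symm
  exact hU (hUx.trans (map_zero U).symm)

/- On `ker A(mu)` the operator `U(mu)* U(lam)` is `(lam - mu)⁻¹ D* A(lam)`, so `A(mu)* A(lam)`
together with the compression of `U(mu)* U(lam)` to `ker A(mu)` is a left multiple of `A(lam)`,
and it is invertible at `lam = mu`. -/
theorem hasSimplePoleInverse_of_inner {A : ℂ → E →L[ℂ] E} {U : ℂ → E →L[ℂ] K} {D : E →L[ℂ] E}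
    {mu : ℂ} (hA : ContinuousAt A mu) (hU : ContinuousAt U mu) (hinj : Function.Injective (U mu))
    (h : ∀ a, A mu a = 0 → ∀ lam b,
      inner ℂ (D a) (A lam b) = (lam - mu) * inner ℂ (U mu a) (U lam b)) :
    HasSimplePoleInverse A mu := by
  set P := (A mu).ker.starProjection
  refine hasSimplePoleInverse_of_eq_mul
    (C := fun lam => adjoint (A mu) * A lam + P * (adjoint (U mu) ∘L U lam))
    (L := fun lam => adjoint (A mu) + (lam - mu)⁻¹ • adjoint (D * P))
    ((continuousAt_const.mul hA).add
      (continuousAt_const.mul (continuousAt_const.clm_comp hU)))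
    (isUnit_adjoint_mul_add _ hinj) ?_ ?_
  · have hsmul : (fun lam => (lam - mu)⁻¹ • adjoint (D * P)) =O[𝓝[≠] mu] fun lam => (lam - mu)⁻¹ :=
      isBigO_of_le' (c := ‖adjoint (D * P)‖) _ fun lam => by rw [norm_smul, mul_comm]
    exact (((isBigO_const_const _ one_ne_zero _).trans (one_isBigO_inv_sub mu))).add hsmul
  · filter_upwards [self_mem_nhdsWithin] with lam (hne : lam ≠ mu)
    rw [starProjection_ker_mul_eq (sub_ne_zero.2 hne) fun a ha => h a ha lam, add_mul,
      smul_mul_assoc]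

end SimplePoleOfInner

section Factorization

open Asymptotics

variable {E F : Type*} [NormedAddCommGroup E] [NormedSpace ℂ E] [FiniteDimensional ℂ E]
  [NormedAddCommGroup F] [NormedSpace ℂ F]

theorem exists_eq_comp_of_ker_le {A : E →L[ℂ] E} {Q : E →L[ℂ] F} (h : ∀ x, A x = 0 → Q x = 0) :
    ∃ Y : E →L[ℂ] F, Q = Y ∘L A := by
  obtain ⟨s, hs⟩ := A.toLinearMap.rangeRestrict.exists_rightInverse_of_surjective
    A.toLinearMap.range_rangeRestrict
  obtain ⟨Y, hY⟩ := (Q.toLinearMap ∘ₗ s).exists_extend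
  refine ⟨Y.toContinuousLinearMap, ContinuousLinearMap.ext fun x => ?_⟩
  set y := A.toLinearMap.rangeRestrict x
  have hAs : A (s y) = A x := congrArg Subtype.val (LinearMap.congr_fun hs y)
  have hQs : Q (s y) = Q x := sub_eq_zero.1 <| by
    rw [← map_sub, h _ (by rw [map_sub, hAs, sub_self])]
  exact hQs.symm.trans (LinearMap.congr_fun hY y).symm

theorem isBigO_one_comp_inverse {A : ℂ → E →L[ℂ] E} {Q : ℂ → E →L[ℂ] F} {mu : ℂ}
    (hA : DifferentiableAt ℂ A mu) (hpole : HasSimplePoleInverse A mu)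
    (hQ : DifferentiableAt ℂ Q mu) (hker : ∀ x, A mu x = 0 → Q mu x = 0) :
    (fun lam => Q lam ∘L Ring.inverse (A lam)) =O[𝓝[≠] mu] fun _ => (1 : ℂ) := by
  obtain ⟨Y, hY⟩ := exists_eq_comp_of_ker_le hker
  have hsub : (fun lam => Q lam - Y ∘L A lam) =O[𝓝 mu] fun lam => lam - mu := by
    have hd : DifferentiableAt ℂ (fun lam => Q lam - Y ∘L A lam) mu :=
      hQ.sub ((differentiableAt_const Y).clm_comp hA)
    simpa only [hY, sub_self, sub_zero] using hd.isBigO_sub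
  have hprod : (fun lam => (Q lam - Y ∘L A lam) ∘L Ring.inverse (A lam)) =O[𝓝[≠] mu]
      fun _ => (1 : ℂ) := by
    have hcomp : (fun lam => (Q lam - Y ∘L A lam) ∘L Ring.inverse (A lam)) =O[𝓝[≠] mu]
        fun lam => ‖Q lam - Y ∘L A lam‖ * ‖Ring.inverse (A lam)‖ :=
      isBigO_of_le _ fun lam => (ContinuousLinearMap.opNorm_comp_le _ _).trans (le_abs_self _)
    refine (hcomp.trans ((hsub.mono nhdsWithin_le_nhds).norm_left.mul
      hpole.isBigO.norm_left)).congr' EventuallyEq.rfl ?_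
    filter_upwards [self_mem_nhdsWithin] with lam (hne : lam ≠ mu)
    exact mul_inv_cancel₀ (sub_ne_zero.2 hne)
  refine (hprod.add (isBigO_const_const Y one_ne_zero _)).congr' ?_ EventuallyEq.rfl
  filter_upwards [hpole.eventually_isUnit] with lam hu
  have hcancel : A lam ∘L Ring.inverse (A lam) = 1 := Ring.mul_inverse_cancel _ hu
  rw [ContinuousLinearMap.sub_comp, ContinuousLinearMap.comp_assoc Y, hcancel]
  exact sub_add_cancel _ _

end Factorization

section Liouville

open Asymptotics

theorem exists_entire_extension {F : Type*} [NormedAddCommGroup F] [NormedSpace ℂ F]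
    [CompleteSpace F] {G : ℂ → F} (hd : ∀ z, ∀ᶠ w in 𝓝[≠] z, DifferentiableAt ℂ G w)
    (hb : ∀ z, G =O[𝓝[≠] z] fun _ => (1 : ℂ)) :
    ∃ g : ℂ → F, Differentiable ℂ g ∧ ∀ z, ContinuousAt G z → g z = G z := by
  have hlim (z : ℂ) (hz : ContinuousAt G z) : limUnder (𝓝[≠] z) G = G z :=
    (hz.tendsto.mono_left nhdsWithin_le_nhds).limUnder_eq
  refine ⟨fun z => limUnder (𝓝[≠] z) G, fun z => ?_, hlim⟩
  obtain ⟨C, hC⟩ := (hb z).bound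
  obtain ⟨s, hs, hsub⟩ := mem_nhdsWithin_iff_exists_mem_nhds_inter.1 ((hd z).and hC)
  have hext : DifferentiableAt ℂ (Function.update G z (limUnder (𝓝[≠] z) G)) z :=
    (Complex.differentiableOn_update_limUnder_of_bddAbove hs
      (fun w hw => (hsub hw).1.differentiableWithinAt)
      ⟨C * ‖(1 : ℂ)‖, forall_mem_image.2 fun w hw => (hsub hw).2⟩).differentiableAt hs
  refine hext.congr_of_eventuallyEq ?_
  filter_upwards [hs] with w hw
  rcases eq_or_ne w z with rfl | hne
  · exact (Function.update_self w _ G).symm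
  · rw [Function.update_of_ne hne]
    exact hlim w (hsub ⟨hw, hne⟩).1.continuousAt

/-- A set that contains the boundaries of arbitrarily large squares and on which `|sin z|` is
comparable to `exp |Im z|`. -/
def sinLargeSet : Set ℂ := {z | Real.cos z.re = 0 ∨ 1 ≤ |z.im|}

theorem sq_norm_sin (z : ℂ) : ‖Complex.sin z‖ ^ 2 = Real.sin z.re ^ 2 + Real.sinh z.im ^ 2 := by
  have hsin : Complex.sin z = ⟨Real.sin z.re * Real.cosh z.im, Real.cos z.re * Real.sinh z.im⟩ := by
    rw [Complex.sin_eq, Complex.mk_eq_add_mul_I]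
    push_cast
    rfl
  rw [hsin, Complex.sq_norm, Complex.normSq_mk]
  linear_combination Real.sin z.re ^ 2 * Real.cosh_sq z.im +
    Real.sinh z.im ^ 2 * Real.sin_sq_add_cos_sq z.re

theorem exp_div_four_le_norm_sin {z : ℂ} (hz : z ∈ sinLargeSet) :
    Real.exp |z.im| / 4 ≤ ‖Complex.sin z‖ := by
  rcases hz with hcos | him
  · have hcosh : ‖Complex.sin z‖ = Real.cosh z.im := by
      refine (sq_eq_sq₀ (norm_nonneg _) (Real.cosh_pos _).le).1 ?_
      rw [sq_norm_sin, Real.sin_sq, hcos, Real.cosh_sq]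
      ring
    rw [hcosh, ← Real.cosh_abs, Real.cosh_eq]
    linarith [Real.exp_pos |z.im|, Real.exp_pos (-|z.im|)]
  · have hsinh : Real.sinh |z.im| ≤ ‖Complex.sin z‖ := by
      refine abs_le_of_sq_le_sq' ?_ (norm_nonneg _) |>.2
      rw [sq_norm_sin, ← Real.abs_sinh, sq_abs]
      exact le_add_of_nonneg_left (sq_nonneg _)
    rw [Real.sinh_eq] at hsinh
    have hneg : Real.exp (-|z.im|) ≤ 1 := Real.exp_le_one_iff.2 (by linarith)
    linarith [Real.add_one_le_exp |z.im|]

theorem exists_square (r : ℝ) : ∃ a, r < a ∧ 1 ≤ a ∧ Real.cos a = 0 := by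
  obtain ⟨n, hn⟩ := exists_nat_gt r
  refine ⟨(2 * (n : ℤ) + 1) * Real.pi / 2, ?_, ?_, Real.cos_eq_zero_iff.2 ⟨n, rfl⟩⟩ <;>
  · push_cast
    nlinarith [Real.pi_gt_three, (n.cast_nonneg : (0 : ℝ) ≤ n)]

theorem mem_sinLargeSet_of_mem_frontier {a : ℝ} (ha : 1 ≤ a) (hcos : Real.cos a = 0) {z : ℂ}
    (hz : z ∈ frontier (Ioo (-a) a ×ℂ Ioo (-a) a)) : z ∈ sinLargeSet ∧ a ≤ ‖z‖ := by
  have hlt : -a < a := by linarith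
  rw [Complex.frontier_reProdIm, closure_Ioo hlt.ne, frontier_Ioo hlt] at hz
  have habs {x : ℝ} (hx : x ∈ ({-a, a} : Set ℝ)) : |x| = a :=
    (abs_eq (by linarith)).2 hx.symm
  rcases hz with ⟨-, him⟩ | ⟨hre, -⟩
  · exact ⟨Or.inr (ha.trans_eq (habs him).symm),
      (habs him).symm.trans_le (Complex.abs_im_le_norm z)⟩
  · refine ⟨Or.inl ?_, (habs hre).symm.trans_le (Complex.abs_re_le_norm z)⟩
    rw [← Real.cos_abs, habs hre, hcos]

variable {F : Type*} [NormedAddCommGroup F] [NormedSpace ℂ F] {B C : ℝ}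

theorem norm_le_of_forall_mem_sinLargeSet {f : ℂ → F} (hf : Differentiable ℂ f)
    (h : ∀ z ∈ sinLargeSet, B ≤ ‖z‖ → ‖f z‖ ≤ C) (z : ℂ) : ‖f z‖ ≤ C := by
  obtain ⟨a, ha, ha1, hcos⟩ := exists_square (max B ‖z‖)
  have hz : ‖z‖ < a := (le_max_right _ _).trans_lt ha
  refine Complex.norm_le_of_forall_mem_frontier_norm_le
    ((Metric.isBounded_Ioo (-a) a).reProdIm (Metric.isBounded_Ioo (-a) a)) hf.diffContOnCl
    (fun ζ hζ => ?_) (subset_closure ⟨abs_lt.1 ((Complex.abs_re_le_norm z).trans_lt hz),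
      abs_lt.1 ((Complex.abs_im_le_norm z).trans_lt hz)⟩)
  obtain ⟨hmem, haζ⟩ := mem_sinLargeSet_of_mem_frontier ha1 hcos hζ
  exact h ζ hmem (((le_max_left _ _).trans_lt ha).le.trans haζ)

theorem eq_of_norm_sq_le_on_sinLargeSet {g : ℂ → F} (hg : Differentiable ℂ g)
    (h : ∀ z ∈ sinLargeSet, B ≤ ‖z‖ → ‖g (z ^ 2)‖ ≤ C) (lam mu : ℂ) : g lam = g mu := by
  have hf : Differentiable ℂ fun z : ℂ => g (z ^ 2) := hg.comp (differentiable_id.pow 2)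
  have hbdd : Bornology.IsBounded (range fun z : ℂ => g (z ^ 2)) :=
    isBounded_iff_forall_norm_le.2 ⟨C, forall_mem_range.2 (norm_le_of_forall_mem_sinLargeSet hf h)⟩
  obtain ⟨z, rfl⟩ := IsAlgClosed.exists_pow_nat_eq lam two_pos
  obtain ⟨ζ, rfl⟩ := IsAlgClosed.exists_pow_nat_eq mu two_pos
  exact hf.apply_eq_apply_of_bounded hbdd z ζ

variable {E : Type*} [NormedAddCommGroup E] [NormedSpace ℂ E] [FiniteDimensional ℂ E]

theorem exists_forall_eq_comp [CompleteSpace F] {A : ℂ → E →L[ℂ] E} {Q : ℂ → E →L[ℂ] F}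
    (hA : Differentiable ℂ A) (hQ : Differentiable ℂ Q) (hpole : ∀ mu, HasSimplePoleInverse A mu)
    (hker : ∀ mu x, A mu x = 0 → Q mu x = 0)
    (hbound : ∀ z ∈ sinLargeSet, B ≤ ‖z‖ → IsUnit (A (z ^ 2)) ∧
      ‖Q (z ^ 2) ∘L Ring.inverse (A (z ^ 2))‖ ≤ C) :
    ∃ Y : E →L[ℂ] F, ∀ lam, Q lam = Y ∘L A lam := by
  have : CompleteSpace E := FiniteDimensional.complete ℂ E
  set G : ℂ → E →L[ℂ] F := fun lam => Q lam ∘L Ring.inverse (A lam)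
  have hGd (lam : ℂ) (hu : IsUnit (A lam)) : DifferentiableAt ℂ G lam :=
    (hQ lam).clm_comp ((hA lam).inverse hu)
  obtain ⟨g, hg, hgG⟩ := exists_entire_extension
    (fun mu => (hpole mu).eventually_isUnit.mono hGd)
    fun mu => isBigO_one_comp_inverse (hA mu) (hpole mu) (hQ mu) (hker mu)
  have hconst (lam : ℂ) : g lam = g 0 := by
    refine eq_of_norm_sq_le_on_sinLargeSet (B := B) (C := C) hg (fun z hz hB => ?_) lam 0
    rw [hgG _ (hGd _ (hbound z hz hB).1).continuousAt]
    exact (hbound z hz hB).2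
  have heq (lam : ℂ) (hu : IsUnit (A lam)) : Q lam = g 0 ∘L A lam := by
    have hcancel : Ring.inverse (A lam) ∘L A lam = 1 := Ring.inverse_mul_cancel _ hu
    rw [← hconst lam, hgG lam (hGd lam hu).continuousAt, ContinuousLinearMap.comp_assoc, hcancel]
    rfl
  have hcont : Continuous fun lam => g 0 ∘L A lam := hA.continuous.const_clm_comp _
  refine ⟨g 0, fun lam => ?_⟩
  exact tendsto_nhds_unique_of_frequently_eq (hQ.continuous.tendsto lam) (hcont.tendsto lam)
    (((hpole lam).eventually_isUnit.mono heq).frequently.filter_mono nhdsWithin_le_nhds)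

end Liouville

section Inverse

open unitInterval

theorem isUnit_and_norm_inverse_le {E : Type*} [NormedAddCommGroup E] [NormedSpace ℂ E]
    [FiniteDimensional ℂ E] {A : E →L[ℂ] E} {c : ℝ} (hc : 0 < c) (h : ∀ x, c * ‖x‖ ≤ ‖A x‖) :
    IsUnit A ∧ ‖Ring.inverse A‖ ≤ c⁻¹ := by
  have hunit : IsUnit A := isUnit_of_injective ((injective_iff_map_eq_zero A).2 fun x hx => by
    have hle := h x
    rw [hx, norm_zero] at hle
    exact norm_le_zero_iff.1 (nonpos_of_mul_nonpos_right hle hc))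
  refine ⟨hunit, ContinuousLinearMap.opNorm_le_bound _ (inv_nonneg.2 hc.le) fun y => ?_⟩
  have hcancel : A (Ring.inverse A y) = y :=
    congrArg (fun T : E →L[ℂ] E => T y) (Ring.mul_inverse_cancel A hunit)
  rw [inv_mul_eq_div, le_div_iff₀' hc]
  exact (h _).trans_eq (congrArg norm hcancel)

theorem le_norm_dirichletValue_sq {H : Type*} [NormedAddCommGroup H] [NormedSpace ℂ H]
    [CompleteSpace H] {w : ℝ → H →L[ℂ] H} (hw : Integrable (fun t : I => w t)) {z : ℂ} (hz : z ≠ 0)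
    (hzw : 16 * (∫ t : I, ‖w t‖) ≤ ‖z‖) (hsin : z ∈ sinLargeSet) (v : H) :
    Real.exp |z.im| / (8 * ‖z‖) * ‖v‖ ≤ ‖dirichletValue hw (z ^ 2) v‖ := by
  have hw0 : 0 ≤ ∫ t : I, ‖w t‖ := integral_nonneg fun _ => norm_nonneg _
  have hz0 : 0 < ‖z‖ := norm_pos_iff.2 hz
  have hmain : Real.exp |z.im| / (4 * ‖z‖) * ‖v‖ ≤ ‖(Complex.sin z / z) • v‖ := by
    rw [norm_smul, norm_div, ← div_div]
    gcongr
    exact exp_div_four_le_norm_sin hsin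
  have herror : ‖dirichletValue hw (z ^ 2) v - (Complex.sin z / z) • v‖ ≤
      Real.exp |z.im| / (8 * ‖z‖) * ‖v‖ := by
    refine ContinuousLinearMap.le_of_opNorm_le
      (dirichletValue hw (z ^ 2) - (Complex.sin z / z) • (1 : H →L[ℂ] H))
      ((norm_dirichletValue_sq_sub_le hw hz (by linarith [hw0])).trans ?_) v
    rw [div_le_div_iff₀ (by positivity) (by positivity)]
    nlinarith [mul_le_mul_of_nonneg_right hzw (mul_pos (Real.exp_pos |z.im|) hz0).le]
  have htriangle := norm_le_insert (dirichletValue hw (z ^ 2) v) ((Complex.sin z / z) • v)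
  have hhalf : Real.exp |z.im| / (4 * ‖z‖) * ‖v‖ = 2 * (Real.exp |z.im| / (8 * ‖z‖) * ‖v‖) := by
    field_simp
    ring
  linarith

variable {H F : Type*} [NormedAddCommGroup H] [InnerProductSpace ℂ H] [CompleteSpace H]
  [NormedAddCommGroup F] [NormedSpace ℂ F] [CompleteSpace F]
  {w w' : ℝ → H →L[ℂ] H} {mu : ℂ}

theorem inner_dirichletDeriv_dirichletValue (hw : Integrable (fun t : I => w t))
    (hsymm : ∀ᵐ t : I, (w t : H →ₗ[ℂ] H).IsSymmetric) (hmu : star mu = mu) {a : H}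
    (ha : dirichletValue hw mu a = 0) (lam : ℂ) (b : H) :
    inner ℂ (dirichletDeriv hw mu a) (dirichletValue hw lam b) =
      (lam - mu) * inner ℂ (dirichletL2 hw mu a) (dirichletL2 hw lam b) := by
  have h := lagrange (mu := mu) (lam := lam) hw hsymm a b
  rw [ha, inner_zero_left, hmu] at h
  linear_combination -h

variable [FiniteDimensional ℂ H]

theorem isUnit_dirichletValue_of_star_ne (hw : Integrable (fun t : I => w t))
    (hsymm : ∀ᵐ t : I, (w t : H →ₗ[ℂ] H).IsSymmetric) (hmu : star mu ≠ mu) :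
    IsUnit (dirichletValue hw mu) := by
  refine isUnit_of_injective ((injective_iff_map_eq_zero _).2 fun a ha => ?_)
  have h := lagrange (mu := mu) (lam := mu) hw hsymm a a
  rw [ha, inner_zero_left, inner_zero_right, sub_zero, eq_comm, mul_eq_zero] at h
  have hL2 : dirichletL2 hw mu a = 0 := inner_self_eq_zero.1 (h.resolve_left (sub_ne_zero.2 hmu))
  exact dirichletL2_injective hw mu (hL2.trans (map_zero _).symm)

theorem hasSimplePoleInverse_dirichletValue (hw : Integrable (fun t : I => w t))
    (hsymm : ∀ᵐ t : I, (w t : H →ₗ[ℂ] H).IsSymmetric) (mu : ℂ) :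
    HasSimplePoleInverse (dirichletValue hw) mu := by
  have hcont : ContinuousAt (dirichletValue hw) mu :=
    (differentiable_dirichletValue hw).continuous.continuousAt
  by_cases hmu : star mu = mu
  · exact hasSimplePoleInverse_of_inner hcont (continuous_dirichletL2 hw).continuousAt
      (dirichletL2_injective hw mu) fun a ha => inner_dirichletDeriv_dirichletValue hw hsymm hmu ha
  · exact hasSimplePoleInverse_of_isUnit hcont (isUnit_dirichletValue_of_star_ne hw hsymm hmu)

theorem exists_comp_dirichletValue_eq (hw : Integrable (fun t : I => w t))
    (hw' : Integrable (fun t : I => w' t))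
    (hsymm' : ∀ᵐ t : I, (w' t : H →ₗ[ℂ] H).IsSymmetric) (Q : H →L[ℂ] F)
    (hker : ∀ (mu : ℝ) (x : H), dirichletValue hw' mu x = 0 → Q (dirichletValue hw mu x) = 0) :
    ∃ Y : H →L[ℂ] F, ∀ lam, Q ∘L dirichletValue hw lam = Y ∘L dirichletValue hw' lam := by
  have hw0 : 0 ≤ ∫ t : I, ‖w t‖ := integral_nonneg fun _ => norm_nonneg _
  have hw0' : 0 ≤ ∫ t : I, ‖w' t‖ := integral_nonneg fun _ => norm_nonneg _
  refine exists_forall_eq_comp (B := 16 * (∫ t : I, ‖w t‖) + 16 * (∫ t : I, ‖w' t‖) + 1)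
    (C := 16 * ‖Q‖) (differentiable_dirichletValue hw')
    ((differentiable_const Q).clm_comp (differentiable_dirichletValue hw))
    (hasSimplePoleInverse_dirichletValue hw' hsymm') (fun mu x hx => ?_) fun z hz hB => ?_
  · by_cases hmu : star mu = mu
    · obtain ⟨r, rfl⟩ := Complex.conj_eq_iff_real.1 hmu
      exact hker r x hx
    · have hx0 : x = 0 := (ContinuousLinearMap.isUnit_iff_bijective.1
        (isUnit_dirichletValue_of_star_ne hw' hsymm' hmu)).injective (hx.trans (map_zero _).symm)
      rw [hx0, map_zero]
  · have hz0 : 0 < ‖z‖ := by linarith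
    have hz1 : z ≠ 0 := norm_pos_iff.1 hz0
    obtain ⟨hunit, hinv⟩ := isUnit_and_norm_inverse_le (by positivity)
      (le_norm_dirichletValue_sq hw' hz1 (by linarith) hz)
    refine ⟨hunit, ?_⟩
    calc ‖(Q ∘L dirichletValue hw (z ^ 2)) ∘L Ring.inverse (dirichletValue hw' (z ^ 2))‖
        ≤ ‖Q‖ * ‖dirichletValue hw (z ^ 2)‖ * ‖Ring.inverse (dirichletValue hw' (z ^ 2))‖ :=
          (ContinuousLinearMap.opNorm_comp_le _ _).trans (mul_le_mul_of_nonneg_right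
            (ContinuousLinearMap.opNorm_comp_le _ _) (norm_nonneg _))
      _ ≤ ‖Q‖ * (2 * Real.exp |z.im| / ‖z‖) * (Real.exp |z.im| / (8 * ‖z‖))⁻¹ := by
          gcongr
          exact norm_dirichletValue_sq_le hw hz1 (by linarith)
      _ = 16 * ‖Q‖ := by
          field_simp
          ring

end Inverse

section Gram

open unitInterval

variable {H : Type*} [NormedAddCommGroup H] [InnerProductSpace ℂ H] [CompleteSpace H]
  {w w' : ℝ → H →L[ℂ] H} {mu : ℂ}

/-- The Gram operator `∫ φ(t, lam)* φ(t, lam) dt` of `dirichletSolution`. -/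
def dirichletGram (hw : Integrable (fun t : I => w t)) (lam : ℂ) : H →L[ℂ] H :=
  (dirichletL2 hw lam).adjoint ∘L dirichletL2 hw lam

theorem inner_dirichletGram (hw : Integrable (fun t : I => w t)) (lam : ℂ) (a b : H) :
    inner ℂ (dirichletGram hw lam a) b =
      inner ℂ (dirichletL2 hw lam a) (dirichletL2 hw lam b) :=
  ContinuousLinearMap.adjoint_inner_left (dirichletL2 hw lam) b (dirichletL2 hw lam a)

theorem continuous_inner_dirichletL2 (hw : Integrable (fun t : I => w t)) (a b : H) :
    Continuous fun lam => inner ℂ (dirichletL2 hw mu a) (dirichletL2 hw lam b) := by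
  have h : Continuous fun lam => dirichletL2 hw lam b :=
    (continuous_dirichletL2 hw).clm_apply continuous_const
  exact (innerSL ℂ (dirichletL2 hw mu a)).continuous.comp h

theorem dirichletGram_eq_of_inner_eq (hw : Integrable (fun t : I => w t))
    (hsymm : ∀ᵐ t : I, (w t : H →ₗ[ℂ] H).IsSymmetric) (hw' : Integrable (fun t : I => w' t))
    (hsymm' : ∀ᵐ t : I, (w' t : H →ₗ[ℂ] H).IsSymmetric) (hmu : star mu = mu) {a a' : H}
    (ha : dirichletValue hw mu a = 0) (ha' : dirichletValue hw' mu a' = 0)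
    (h : ∀ lam b, inner ℂ (dirichletDeriv hw mu a) (dirichletValue hw lam b) =
      inner ℂ (dirichletDeriv hw' mu a') (dirichletValue hw' lam b)) :
    dirichletGram hw mu a = dirichletGram hw' mu a' := by
  refine ext_inner_right ℂ fun b => ?_
  rw [inner_dirichletGram, inner_dirichletGram]
  have hlim := ((continuous_inner_dirichletL2 (mu := mu) hw a b).tendsto mu).mono_left
    (nhdsWithin_le_nhds (s := {mu}ᶜ))
  have hlim' := ((continuous_inner_dirichletL2 (mu := mu) hw' a' b).tendsto mu).mono_left
    (nhdsWithin_le_nhds (s := {mu}ᶜ))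
  refine tendsto_nhds_unique (hlim.congr' ?_) hlim'
  filter_upwards [self_mem_nhdsWithin] with lam (hne : lam ≠ mu)
  refine mul_left_cancel₀ (sub_ne_zero.2 hne) ?_
  rw [← inner_dirichletDeriv_dirichletValue hw hsymm hmu ha,
    ← inner_dirichletDeriv_dirichletValue hw' hsymm' hmu ha', h]

theorem dirichletGram_injective (hw : Integrable (fun t : I => w t)) (lam : ℂ) :
    Function.Injective (dirichletGram hw lam) :=
  (injective_iff_map_eq_zero _).2 fun a ha => dirichletL2_injective hw lam <| by
    rw [map_zero, ← inner_self_eq_zero (𝕜 := ℂ), ← inner_dirichletGram, ha, inner_zero_left]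

theorem eq_zero_of_dirichletDeriv_eq_zero (hw : Integrable (fun t : I => w t))
    (hsymm : ∀ᵐ t : I, (w t : H →ₗ[ℂ] H).IsSymmetric) (hmu : star mu = mu) {a : H}
    (ha : dirichletValue hw mu a = 0) (ha' : dirichletDeriv hw mu a = 0) : a = 0 :=
  dirichletGram_injective hw mu <| dirichletGram_eq_of_inner_eq hw hsymm hw hsymm hmu ha
    (map_zero _) fun lam b => by rw [ha', map_zero]

theorem disjoint_ker_orthogonal_map_dirichletGram (hw : Integrable (fun t : I => w t)) (lam : ℂ) :
    Disjoint (dirichletValue hw lam).ker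
      ((dirichletValue hw lam).ker.map (dirichletGram hw lam : H →ₗ[ℂ] H))ᗮ := by
  refine Submodule.disjoint_def.2 fun a ha horth => dirichletL2_injective hw lam ?_
  have h : inner ℂ (dirichletGram hw lam a) a = 0 :=
    (Submodule.mem_orthogonal _ _).1 horth _ (Submodule.mem_map_of_mem ha)
  rw [inner_dirichletGram, inner_self_eq_zero] at h
  rw [h, map_zero]

variable [FiniteDimensional ℂ H]

theorem map_dirichletDeriv_ker (hw : Integrable (fun t : I => w t))
    (hsymm : ∀ᵐ t : I, (w t : H →ₗ[ℂ] H).IsSymmetric) (hmu : star mu = mu) :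
    (dirichletValue hw mu).ker.map (dirichletDeriv hw mu : H →ₗ[ℂ] H) =
      (dirichletValue hw mu).rangeᗮ := by
  set M := dirichletValue hw mu
  refine Submodule.eq_of_le_of_finrank_eq ?_ ?_
  · rintro _ ⟨a, ha, rfl⟩
    refine (Submodule.mem_orthogonal' _ _).2 ?_
    rintro _ ⟨b, rfl⟩
    have h := inner_dirichletDeriv_dirichletValue hw hsymm hmu ha mu b
    rwa [sub_self, zero_mul] at h
  · have hinj : Function.Injective ((dirichletDeriv hw mu : H →ₗ[ℂ] H).domRestrict M.ker) :=
      (injective_iff_map_eq_zero _).2 fun a ha =>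
        Subtype.ext (eq_zero_of_dirichletDeriv_eq_zero hw hsymm hmu a.2 ha)
    rw [← LinearMap.range_domRestrict, LinearMap.finrank_range_of_inj hinj]
    have horth := M.range.finrank_add_finrank_orthogonal
    have hrank := M.toLinearMap.finrank_range_add_finrank_ker
    omega

theorem map_dirichletGram_ker_le (hw : Integrable (fun t : I => w t))
    (hsymm : ∀ᵐ t : I, (w t : H →ₗ[ℂ] H).IsSymmetric) (hw' : Integrable (fun t : I => w' t))
    (hsymm' : ∀ᵐ t : I, (w' t : H →ₗ[ℂ] H).IsSymmetric) {mu : ℝ}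
    (hker : ∀ nu : ℝ, nu ≠ mu → (dirichletValue hw' nu).ker ≤ (dirichletValue hw nu).ker) :
    (dirichletValue hw mu).ker.map (dirichletGram hw mu : H →ₗ[ℂ] H) ≤
      (dirichletValue hw' mu).ker.map (dirichletGram hw' mu : H →ₗ[ℂ] H) := by
  rintro _ ⟨a, ha, rfl⟩
  have hmu : star (mu : ℂ) = mu := Complex.conj_ofReal mu
  have hzero (b : H) : inner ℂ (dirichletDeriv hw mu a) (dirichletValue hw mu b) = 0 := by
    rw [inner_dirichletDeriv_dirichletValue hw hsymm hmu ha, sub_self, zero_mul]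
  obtain ⟨Y, hY⟩ := exists_comp_dirichletValue_eq hw hw' hsymm'
    (innerSL ℂ (dirichletDeriv hw mu a)) fun nu x hx => by
      rcases eq_or_ne nu mu with rfl | hne
      · exact hzero x
      · have hx0 : dirichletValue hw nu x = 0 := hker nu hne hx
        rw [hx0, map_zero]
  set c := (InnerProductSpace.toDual ℂ H).symm Y
  have hc (lam : ℂ) (b : H) : inner ℂ (dirichletDeriv hw mu a) (dirichletValue hw lam b) =
      inner ℂ c (dirichletValue hw' lam b) :=
    (congrArg (fun T : H →L[ℂ] ℂ => T b) (hY lam)).trans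
      (InnerProductSpace.toDual_symm_apply (𝕜 := ℂ) (y := Y) (x := dirichletValue hw' lam b)).symm
  have hcorth : c ∈ (dirichletValue hw' mu).rangeᗮ := by
    refine (Submodule.mem_orthogonal' _ _).2 ?_
    rintro _ ⟨b, rfl⟩
    exact (hc mu b).symm.trans (hzero b)
  rw [← map_dirichletDeriv_ker hw' hsymm' hmu] at hcorth
  obtain ⟨a', ha', hac⟩ := hcorth
  exact ⟨a', ha', (dirichletGram_eq_of_inner_eq hw hsymm hw' hsymm' hmu ha ha' fun lam b =>
    (hc lam b).trans (congrArg (fun y => inner ℂ y _) hac.symm)).symm⟩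

end Gram

section MatrixSolution

open unitInterval

variable {N : ℕ} {V : ℝ → Matrix (Fin N) (Fin N) ℂ} {lam : ℂ} {ψ p : ℝ → EuclideanSpace ℂ (Fin N)}

/-- The matrix potential as an operator-valued coefficient, so that solutions of the matrix equation
are instances of `IsSolutionPair`. -/
def potentialOperator (V : ℝ → Matrix (Fin N) (Fin N) ℂ) (t : ℝ) :
    EuclideanSpace ℂ (Fin N) →L[ℂ] EuclideanSpace ℂ (Fin N) :=
  Matrix.toEuclideanCLM (n := Fin N) (𝕜 := ℂ) (V t)

theorem IsPotential.integrable (hV : IsPotential V) :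
    Integrable (fun t : I => potentialOperator V t) := by
  have hsum (t : ℝ) : potentialOperator V t = ∑ i, ∑ j, V t i j •
      Matrix.toEuclideanCLM (n := Fin N) (𝕜 := ℂ) (Matrix.single i j 1) := by
    simp only [potentialOperator, ← map_smul, Matrix.smul_single, smul_eq_mul, mul_one, ← map_sum,
      ← Matrix.matrix_eq_sum_single]
  rw [integrable_unitInterval_iff, intervalIntegrable_iff_integrableOn_Ioo_of_le zero_le_one,
    funext hsum]
  exact integrable_finsetSum _ fun i _ => integrable_finsetSum _ fun j _ =>
    (hV.1 i j).smul_const _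

theorem IsPotential.isSymmetric (hV : IsPotential V) :
    ∀ᵐ t : I, (potentialOperator V t : EuclideanSpace ℂ (Fin N) →ₗ[ℂ] _).IsSymmetric := by
  refine (ae_unitInterval_iff (P := fun t => (potentialOperator V t :
    EuclideanSpace ℂ (Fin N) →ₗ[ℂ] EuclideanSpace ℂ (Fin N)).IsSymmetric)).2 ?_
  rw [← restrict_Ioo_eq_restrict_Icc]
  exact hV.2.mono fun t ht => Matrix.isSymmetric_toEuclideanLin_iff.2 ht

theorem isSolution_iff :
    IsSolution V lam ψ p ↔ IsSolutionPair (potentialOperator V) lam ψ p := by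
  constructor
  · intro h
    refine ⟨⟨h.continuousOn_deriv.intervalIntegrable_of_Icc zero_le_one, ?_⟩,
      h.integrable_rhs, ?_⟩ <;> rw [uIcc_of_le zero_le_one]
    exacts [h.eq_integral, h.deriv_eq_integral]
  · rintro ⟨hψ, hp⟩
    have hc := hp.continuousOn
    have h1 := hψ.eq_add_integral
    have h2 := hp.eq_add_integral
    rw [uIcc_of_le zero_le_one] at hc h1 h2
    exact ⟨hc, hp.intervalIntegrable, h1, h2⟩

theorem toEuclideanLin_of_columns (u : Fin N → EuclideanSpace ℂ (Fin N))
    (h : EuclideanSpace ℂ (Fin N)) :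
    Matrix.toEuclideanLin (Matrix.of fun i j => u j i) h = ∑ j, h j • u j := by
  ext i
  simp [Matrix.toEuclideanLin, Matrix.mulVec, dotProduct, mul_comm]

theorem IsSolution.sum {ι : Type*} (s : Finset ι) {ψ p : ι → ℝ → EuclideanSpace ℂ (Fin N)}
    (h : ∀ j, IsSolution V lam (ψ j) (p j)) :
    IsSolution V lam (∑ j ∈ s, ψ j) (∑ j ∈ s, p j) := by
  classical
  induction s using Finset.induction_on with
  | empty => exact IsSolution.zero V lam
  | insert j s hj ih =>
    rw [Finset.sum_insert hj, Finset.sum_insert hj]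
    exact (h j).add ih

theorem exists_isDirichletSolution (hV : IsPotential V) (lam : ℂ) :
    ∃ Φ, IsDirichletSolution V lam Φ := by
  choose ψ p hψ hψ0 hp0 using fun j : Fin N =>
    exists_isSolutionPair hV.integrable lam (EuclideanSpace.single j 1)
  refine ⟨fun x => Matrix.of fun i j => ψ j x i, fun x => Matrix.of fun i j => p j x i,
    fun h => ?_, ?_, ?_⟩
  · have hsum := IsSolution.sum Finset.univ fun j => (isSolution_iff.2 (hψ j)).smul (h j)
    convert hsum using 1 <;> ext1 x <;>
      simp only [toEuclideanLin_of_columns, Finset.sum_apply, Pi.smul_apply]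
  · ext i j
    simp [hψ0]
  · ext i j
    simp [hp0, Matrix.one_apply]

theorem toEuclideanLin_phi (hV : IsPotential V) (lam : ℂ) (x : I) (h : EuclideanSpace ℂ (Fin N)) :
    Matrix.toEuclideanLin (phi V lam x) h = dirichletSolution hV.integrable lam h x := by
  obtain ⟨P, hsol, h0, hP⟩ : IsDirichletSolution V lam (phi V lam) :=
    Classical.epsilon_spec (exists_isDirichletSolution hV lam)
  have h := (isSolution_iff.1 (hsol h)).eq_dirichletSolution hV.integrable (by simp [h0]) x
  simpa [hP] using h

theorem E_eq_ker (hV : IsPotential V) (α : ℕ) :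
    E V α = (dirichletValue hV.integrable (eigenvalue V α)).ker :=
  congrArg LinearMap.ker (LinearMap.ext (toEuclideanLin_phi hV _ 1))

theorem inner_toEuclideanLin_single (A B : Matrix (Fin N) (Fin N) ℂ) (i j : Fin N) :
    inner ℂ (Matrix.toEuclideanLin A (EuclideanSpace.single i 1))
      (Matrix.toEuclideanLin B (EuclideanSpace.single j 1)) = (Aᴴ * B) i j := by
  simp [PiLp.inner_apply, Matrix.mul_apply, mul_comm]

theorem toEuclideanLin_S (hV : IsPotential V) (α : ℕ) :
    Matrix.toEuclideanLin (S V α) =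
      (dirichletGram hV.integrable (eigenvalue V α) : _ →ₗ[ℂ] EuclideanSpace ℂ (Fin N)) := by
  obtain ⟨G, hG⟩ := (Matrix.toEuclideanLin (m := Fin N) (n := Fin N)).surjective
    (dirichletGram hV.integrable (eigenvalue V α) : _ →ₗ[ℂ] EuclideanSpace ℂ (Fin N))
  rw [← hG]
  congr 1
  ext i j
  let φ (k : Fin N) := dirichletSolution hV.integrable (eigenvalue V α) (EuclideanSpace.single k 1)
  calc S V α i j = ∫ t : I, ((phi V (eigenvalue V α) t)ᴴ * phi V (eigenvalue V α) t) i j :=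
        (integral_unitInterval fun t =>
          ((phi V (eigenvalue V α) t)ᴴ * phi V (eigenvalue V α) t) i j).symm
    _ = ∫ t : I, inner ℂ (φ i t) (φ j t) := by
        simp only [← inner_toEuclideanLin_single, toEuclideanLin_phi hV, φ]
    _ = inner ℂ (EuclideanSpace.single i 1)
          (Matrix.toEuclideanLin G (EuclideanSpace.single j 1)) := by
        rw [← inner_dirichletL2, hG]
        exact (ContinuousLinearMap.adjoint_inner_right _ _ _).symm
    _ = G i j := by
        simpa using inner_toEuclideanLin_single 1 G i j

end MatrixSolution

section Enumeration

theorem isLeast_csInf_of_finite {α : Type*} [ConditionallyCompleteLinearOrder α] {s : Set α}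
    (hs : s.Nonempty) (hfin : ∀ x, (s ∩ Iic x).Finite) : IsLeast s (sInf s) := by
  obtain ⟨x, hx⟩ := hs
  obtain ⟨y, hy, hmin⟩ := exists_min_image _ id (hfin x) ⟨x, hx, le_rfl⟩
  have hleast : IsLeast s y := ⟨hy.1, fun z hz => (le_total z x).elim (fun h => hmin z ⟨hz, h⟩)
    fun h => hy.2.trans h⟩
  rwa [hleast.csInf_eq]

theorem exists_eq_of_isLeast_succ {α : Type*} [LinearOrder α] {s : Set α} {u : ℕ → α}
    (hfin : ∀ x, (s ∩ Iic x).Finite) (hzero : s.Nonempty → IsLeast s (u 0))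
    (hsucc : ∀ n, (s ∩ Ioi (u n)).Nonempty → IsLeast (s ∩ Ioi (u n)) (u (n + 1))) {x : α}
    (hx : x ∈ s) : ∃ n, u n = x := by
  by_contra! hne
  have hlt (n : ℕ) : u n ∈ s ∧ u n < x := by
    induction n with
    | zero => exact ⟨(hzero ⟨x, hx⟩).1, ((hzero ⟨x, hx⟩).2 hx).lt_of_ne (hne 0)⟩
    | succ n ih =>
      have hleast := hsucc n ⟨x, hx, ih.2⟩
      exact ⟨hleast.1.1, (hleast.2 ⟨hx, ih.2⟩).lt_of_ne (hne _)⟩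
  have hmono : StrictMono u := strictMono_nat_of_lt_succ fun n => (hsucc n ⟨x, hx, (hlt n).2⟩).1.2
  exact infinite_of_injective_forall_mem hmono.injective
    (fun n => mem_inter (hlt n).1 (hlt n).2.le) (hfin x)

theorem finite_inter_Iic_of_eventually_notMem {α : Type*} [ConditionallyCompleteLinearOrder α]
    [TopologicalSpace α] [OrderTopology α] {s : Set α} (hs : BddBelow s)
    (hdiscrete : ∀ x, ∀ᶠ y in 𝓝[≠] x, y ∉ s) (b : α) : (s ∩ Iic b).Finite := by
  obtain ⟨a, ha⟩ := hs
  refine not_infinite.1 fun hinf => ?_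
  obtain ⟨x, -, hx⟩ := hinf.exists_accPt_of_subset_isCompact (isCompact_Icc (a := a) (b := b))
    fun y hy => ⟨ha hy.1, hy.2⟩
  rw [accPt_iff_frequently_nhdsNE] at hx
  exact hx ((hdiscrete x).mono fun y hy h => hy h.1)

end Enumeration

section Eigenvalues

open unitInterval

variable {H : Type*} [NormedAddCommGroup H] [NormedSpace ℂ H] {w : ℝ → H →L[ℂ] H}

theorem IsSolutionPair.congr {lam : ℂ} {ψ χ p : ℝ → H} (h : IsSolutionPair w lam ψ p)
    (hχ : EqOn ψ χ (Icc 0 1)) : IsSolutionPair w lam χ p := by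
  rw [← uIcc_of_le zero_le_one] at hχ
  have hrhs : EqOn (fun t => w t (ψ t) - lam • ψ t) (fun t => w t (χ t) - lam • χ t) (uIcc 0 1) :=
    fun t ht => by simp only [hχ ht]
  refine ⟨⟨h.isPrimitiveOn.intervalIntegrable, fun x hx => ?_⟩,
    h.isPrimitiveOn_deriv.intervalIntegrable.congr (hrhs.mono uIoc_subset_uIcc), fun x hx => ?_⟩
  · rw [← hχ hx, ← hχ left_mem_uIcc]
    exact h.isPrimitiveOn.eq_add_integral x hx
  · rw [← intervalIntegral.integral_congr (hrhs.mono (uIcc_subset_uIcc_left hx))]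
    exact h.isPrimitiveOn_deriv.eq_add_integral x hx

variable [CompleteSpace H]

theorem bddBelow_setOf_ker_ne_bot (hw : Integrable (fun t : I => w t)) :
    BddBelow {mu : ℝ | (dirichletValue hw mu).ker ≠ ⊥} := by
  have hw0 : 0 ≤ ∫ t : I, ‖w t‖ := integral_nonneg fun _ => norm_nonneg _
  set R : ℝ := 16 * (∫ t : I, ‖w t‖) + 1
  refine ⟨-R ^ 2, fun mu hmu => not_lt.1 fun hlt => hmu ?_⟩
  set y := √(-mu)
  set z := (y : ℂ) * Complex.I
  have hR : 1 ≤ R := le_add_of_nonneg_left (mul_nonneg (by norm_num) hw0)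
  have hy : R ≤ y := Real.le_sqrt_of_sq_le (by linarith)
  have hz : z ^ 2 = mu := by
    rw [mul_pow, Complex.I_sq, ← Complex.ofReal_pow, Real.sq_sqrt (by nlinarith)]
    push_cast
    ring
  have hnorm : ‖z‖ = y := by
    rw [norm_mul, Complex.norm_I, mul_one, Complex.norm_real, Real.norm_of_nonneg (by linarith)]
  have him : z.im = y := by rw [Complex.im_ofReal_mul, Complex.I_im, mul_one]
  have hz0 : 0 < ‖z‖ := hnorm ▸ one_pos.trans_le (hR.trans hy)
  refine LinearMap.ker_eq_bot'.2 fun v (hv : dirichletValue hw mu v = 0) => ?_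
  have hle := le_norm_dirichletValue_sq hw (norm_pos_iff.1 hz0) (by linarith)
    (Or.inr (by rw [him]; exact le_abs.2 (Or.inl (by linarith)))) v
  rw [hz, hv, norm_zero] at hle
  exact norm_le_zero_iff.1 (nonpos_of_mul_nonpos_right hle (by positivity))

end Eigenvalues

section MatrixEigenvalues

variable {N : ℕ} {V : ℝ → Matrix (Fin N) (Fin N) ℂ}

theorem mem_eigenvalues_iff (hV : IsPotential V) {mu : ℝ} :
    mu ∈ eigenvalues V ↔ (dirichletValue hV.integrable mu).ker ≠ ⊥ := by
  rw [Submodule.ne_bot_iff]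
  refine (Submodule.ne_bot_iff _).trans ⟨?_, ?_⟩
  · rintro ⟨ψ, ⟨hout, h0, h1, p, hψ⟩, hne⟩
    have heq := (isSolution_iff.1 hψ).eq_dirichletSolution hV.integrable h0
    refine ⟨p 0, (heq 1).symm.trans h1, fun hp => hne (funext fun x => ?_)⟩
    by_cases hx : x ∈ Icc (0 : ℝ) 1
    · rw [heq ⟨x, hx⟩, hp, map_zero]
      rfl
    · exact hout x hx
  · rintro ⟨a, ha, hne⟩
    obtain ⟨ψ, p, hψ, h0, rfl⟩ := exists_isSolutionPair hV.integrable mu a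
    have heq := hψ.eq_dirichletSolution hV.integrable h0
    have hψ' : EqOn ψ ((Icc 0 1).indicator ψ) (Icc 0 1) := fun x hx => (indicator_of_mem hx ψ).symm
    refine ⟨(Icc 0 1).indicator ψ, ⟨fun x hx => indicator_of_notMem hx ψ, ?_, ?_, p,
      isSolution_iff.2 (hψ.congr hψ')⟩, fun hzero => hne ?_⟩
    · rw [← hψ' (left_mem_Icc.2 zero_le_one), h0]
    · rw [← hψ' (right_mem_Icc.2 zero_le_one)]
      exact (heq 1).trans ha
    · refine dirichletSolution_injective hV.integrable mu (ContinuousMap.ext fun x => ?_)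
      rw [← heq, hψ' x.2, hzero, map_zero]
      rfl

theorem finite_eigenvalues_inter_Iic (hV : IsPotential V) (mu : ℝ) :
    (eigenvalues V ∩ Iic mu).Finite := by
  have heigenvalues : eigenvalues V = {mu : ℝ | (dirichletValue hV.integrable mu).ker ≠ ⊥} :=
    Set.ext fun _ => mem_eigenvalues_iff hV
  rw [heigenvalues]
  refine finite_inter_Iic_of_eventually_notMem (bddBelow_setOf_ker_ne_bot hV.integrable)
    (fun x => ?_) mu
  have hofReal : Tendsto (fun y : ℝ => (y : ℂ)) (𝓝[≠] x) (𝓝[≠] (x : ℂ)) :=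
    Complex.continuous_ofReal.continuousAt.continuousWithinAt.tendsto_nhdsWithin fun y hy =>
      Complex.ofReal_injective.ne hy
  filter_upwards [hofReal.eventually
    (hasSimplePoleInverse_dirichletValue hV.integrable hV.isSymmetric x).eventually_isUnit]
    with y hy hker
  exact hker (LinearMap.ker_eq_bot.2 (ContinuousLinearMap.isUnit_iff_bijective.1 hy).injective)

theorem exists_eigenvalue_eq (hV : IsPotential V) {mu : ℝ} (hmu : mu ∈ eigenvalues V) :
    ∃ n, eigenvalue V n = mu := by
  have hfin := finite_eigenvalues_inter_Iic hV
  refine exists_eq_of_isLeast_succ hfin (fun h => isLeast_csInf_of_finite h hfin)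
    (fun n h => isLeast_csInf_of_finite h fun x => ?_) hmu
  exact (hfin x).subset (inter_subset_inter_left _ inter_subset_left)

end MatrixEigenvalues

section Isospectral

variable {N : ℕ} {V W : ℝ → Matrix (Fin N) (Fin N) ℂ}

theorem ker_dirichletValue_le (hV : IsPotential V) (hW : IsPotential W)
    (hlam : ∀ β, eigenvalue W β = eigenvalue V β) {α : ℕ} (hE : ∀ β, β ≠ α → E W β ≤ E V β)
    {nu : ℝ} (hnu : nu ≠ eigenvalue V α) :
    (dirichletValue hW.integrable nu).ker ≤ (dirichletValue hV.integrable nu).ker := by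
  by_cases hker : (dirichletValue hW.integrable nu).ker = ⊥
  · exact hker.trans_le bot_le
  obtain ⟨β, rfl⟩ := exists_eigenvalue_eq hW ((mem_eigenvalues_iff hW).2 hker)
  have hβ : β ≠ α := fun h => hnu (h ▸ hlam β)
  rw [← E_eq_ker hW, hlam β, ← E_eq_ker hV]
  exact hE β hβ

theorem map_S_E_le (hV : IsPotential V) (hW : IsPotential W)
    (hlam : ∀ β, eigenvalue W β = eigenvalue V β) {α : ℕ} (hE : ∀ β, β ≠ α → E W β ≤ E V β) :
    (E V α).map (Matrix.toEuclideanLin (S V α)) ≤ (E W α).map (Matrix.toEuclideanLin (S W α)) := by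
  rw [toEuclideanLin_S hV, toEuclideanLin_S hW, E_eq_ker hV, E_eq_ker hW, hlam α]
  exact map_dirichletGram_ker_le hV.integrable hV.isSymmetric hW.integrable hW.isSymmetric
    fun nu hnu => ker_dirichletValue_le hV hW hlam hE hnu

theorem F_eq_of_eigenvalue_eq (hV : IsPotential V) (hW : IsPotential W)
    (hlam : ∀ β, eigenvalue W β = eigenvalue V β) {α : ℕ} (hE : ∀ β, β ≠ α → E W β = E V β) :
    F W α = F V α :=
  congrArg Submodule.orthogonal (le_antisymm
    (map_S_E_le hW hV (fun β => (hlam β).symm) fun β hβ => (hE β hβ).ge)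
    (map_S_E_le hV hW hlam fun β hβ => (hE β hβ).le))

theorem disjoint_E_F (hV : IsPotential V) (α : ℕ) : Disjoint (E V α) (F V α) := by
  rw [F, toEuclideanLin_S hV, E_eq_ker hV]
  exact disjoint_ker_orthogonal_map_dirichletGram hV.integrable _

end Isospectral

end MatrixSchrodinger

end

theorem proposition1p4_general {N : ℕ} (V W : ℝ → Matrix (Fin N) (Fin N) ℂ)
    (hV : MatrixSchrodinger.IsPotential V) (hW : MatrixSchrodinger.IsPotential W)
    (hlam : ∀ β : ℕ, MatrixSchrodinger.eigenvalue W β = MatrixSchrodinger.eigenvalue V β) (α : ℕ)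
    (hE : ∀ β : ℕ, β ≠ α → MatrixSchrodinger.E W β = MatrixSchrodinger.E V β) :
    MatrixSchrodinger.F W α = MatrixSchrodinger.F V α ∧
      MatrixSchrodinger.E W α ⊓ MatrixSchrodinger.F V α = ⊥ := by
  have hF := MatrixSchrodinger.F_eq_of_eigenvalue_eq hV hW hlam hE
  refine ⟨hF, ?_⟩
  rw [← hF]
  exact (MatrixSchrodinger.disjoint_E_F hW α).eq_bot

theorem proposition1p4 {N : ℕ} (V W : ℝ → Matrix (Fin N) (Fin N) ℂ)
    (hV : MatrixSchrodinger.IsPotential V) (hW : W ∈ MatrixSchrodinger.Iso V) (α : ℕ)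
    (hE : ∀ β : ℕ, β ≠ α → MatrixSchrodinger.E W β = MatrixSchrodinger.E V β) :
    MatrixSchrodinger.F W α = MatrixSchrodinger.F V α ∧
      MatrixSchrodinger.E W α ⊓ MatrixSchrodinger.F V α = ⊥ :=
  proposition1p4_general V W hV hW.1 (fun β => (hW.2 β).1) α hE
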